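/- A digraph $\Gamma$ is a vertex set together with a set of ordered pairs of vertices (arcs); $G=\mathrm{Aut}(\Gamma)$, and $\mathrm{in}(v)$, $\mathrm{out}(v)$ are the sets of in- and out-neighbours of $v$, whose cardinalities are the in- and out-valency. The digraph $\Gamma$ is vertex-transitive, arc-transitive or $2$-arc-transitive if $G$ is transitive on vertices, on arcs, or on the sequences $(v_0,v_1,v_2)$ with $(v_0,v_1),(v_1,v_2)$ arcs. It is two-ended if its underlying undirected graph is connected and has exactly two ends, where ends are classes of rays (one-way infinite paths), two rays being equivalent if there are infinitely many pairwise disjoint paths from one to the other. Let $\vec{\mathbb Z}$ be the digraph on $\mathbb Z$ with arcs $(i,i+1)$, and let $\mathbb Z$ also denote the digraph on $\mathbb Z$ with arcs $(i,i+1)$ and $(i+1,i)$. A connected digraph has Property Z if it has a surjective digraph homomorphism to $\vec{\mathbb Z}$. For $N\le G$, the quotient digraph $\Gamma/N$ has the $N$-orbits on vertices as its vertices, with an arc from $A$ to $B$ if some arc of $\Gamma$ goes from $A$ to $B$. A transitive group action is quasi-primitive if every normal subgroup acts trivially or transitively; $\Gamma$ is locally quasi-primitive if each vertex stabilizer $G_v$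 acts quasi-primitively on both $\mathrm{in}(v)$ and $\mathrm{out}(v)$. Let $\Gamma$ be a vertex- and arc-transitive two-ended digraph. Then $G$ has a normal subgroup $N$ with finite orbits on the vertices such that either (i) $\Gamma/N\cong\mathbb Z$ and $G/N\cong D_\infty$, or (ii) $\Gamma/N\cong\vec{\mathbb Z}$ and $G/N\cong\mathbb Z$. For any such $N$ and any such isomorphism of $\Gamma/N$ with $\mathbb Z$ or $\vec{\mathbb Z}$, let $\varphi$ be the resulting map from the vertices of $\Gamma$ to $\mathbb Z$, and put $\Gamma_i=\varphi^{-1}(i)$. Then: (a) Case (i) occurs precisely when, for all $i$, every vertex in $\Gamma_i$ has both in-neighbours and out-neighbours in each of $\Gamma_{i-1}$ and $\Gamma_{i+1}$. In that case, every vertex in $\Gamma_i$ has as many out-neighbours in $\Gamma_{i-1}$ as in $\Gamma_{i+1}$, and as many in-neighbours in $\Gamma_{i-1}$ as in $\Gamma_{i+1}$; and the subdigraph spanned by $\Gamma_i\cup\Gamma_{i+1}$ is bipartite, vertex-transitive and arc-transitive. (b) Case (ii) occurs precisely when, for all $i$, every vertex in $\Gamma_i$ has all of its in-neighbours in $\Gamma_{i-1}$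 and all of its out-neighbours in $\Gamma_{i+1}$. In that case, the subdigraph spanned by $\Gamma_i\cup\Gamma_{i+1}$ is bipartite and arc-transitive, and all its arcs have their initial vertex in $\Gamma_i$ and their terminal vertex in $\Gamma_{i+1}$. (c) The in-valency of $\Gamma$ is equal to the out-valency. (d) If the out-valency of $\Gamma$ is odd, then $\Gamma$ has Property Z. (e) If $\Gamma$ is $2$-arc-transitive, then $\Gamma/N\cong\vec{\mathbb Z}$ and $\Gamma$ has Property Z. (f) If $\Gamma$ is locally quasi-primitive and the stabilizer of a vertex in $G$ has more than $2$ elements, then $\Gamma$ has Property Z. (g) If the out-valency of $\Gamma$ is $2$ and the stabilizer of a vertex in $G$ has more than $2$ elements, then $\Gamma$ has Property Z. -/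

import Mathlib

universe u

namespace Digraph

variable {V : Type u}

/-- The automorphism group of a digraph. -/
abbrev Aut (Γ : Digraph V) : Type u := Γ.Adj ≃r Γ.Adj

/-- Isomorphism of digraphs. -/
abbrev Iso {W : Type*} (Γ : Digraph V) (Δ : Digraph W) := Γ.Adj ≃r Δ.Adj

/-- The set of in-neighbours of `v`. -/
def inSet (Γ : Digraph V) (v : V) : Set V := {u | Γ.Adj u v}

/-- The set of out-neighbours of `v`. -/
def outSet (Γ : Digraph V) (v : V) : Set V := {u | Γ.Adj v u}

/-- The in-valency of `v`, a cardinal number. -/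
noncomputable def inValency (Γ : Digraph V) (v : V) : Cardinal.{u} := Cardinal.mk (Γ.inSet v)

/-- The out-valency of `v`, a cardinal number. -/
noncomputable def outValency (Γ : Digraph V) (v : V) : Cardinal.{u} := Cardinal.mk (Γ.outSet v)

/-! ### Transitivity -/

/-- The automorphism group is transitive on vertices. -/
def IsVertexTransitive (Γ : Digraph V) : Prop :=
  ∀ u v : V, ∃ g : Γ.Aut, g u = v

/-- The automorphism group is transitive on arcs. -/
def IsArcTransitive (Γ : Digraph V) : Prop :=
  ∀ u v u' v' : V, Γ.Adj u v → Γ.Adj u' v' → ∃ g : Γ.Aut, g u = u' ∧ g v = v'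

/-- `a 0, …, a k` is a `k`-arc. -/
def IsKArc (Γ : Digraph V) (k : ℕ) (a : Fin (k + 1) → V) : Prop :=
  ∀ i : Fin k, Γ.Adj (a i.castSucc) (a i.succ)

/-- The automorphism group is transitive on `k`-arcs. -/
def IsKArcTransitive (Γ : Digraph V) (k : ℕ) : Prop :=
  ∀ a b : Fin (k + 1) → V, Γ.IsKArc k a → Γ.IsKArc k b → ∃ g : Γ.Aut, ∀ i, g (a i) = b i

/-! ### Connectedness, ends -/

/-- Connectedness of the underlying undirected graph. -/
def IsConnected (Γ : Digraph V) : Prop := Γ.toSimpleGraphInclusive.Connected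

/-- A ray: a one-way infinite path (arcs may be traversed in either direction). -/
def IsRay (Γ : Digraph V) (r : ℕ → V) : Prop :=
  Function.Injective r ∧ ∀ n, Γ.Adj (r n) (r (n + 1)) ∨ Γ.Adj (r (n + 1)) (r n)

/-- Two rays belong to the same end: there is an infinite family of pairwise disjoint paths
(of length `≥ 0`), each with its initial vertex on `r` and its terminal vertex on `s`. -/
def SameEnd (Γ : Digraph V) (r s : ℕ → V) : Prop :=
  ∃ (a b : ℕ → V) (P : ∀ n, Γ.toSimpleGraphInclusive.Path (a n) (b n)),
    (∀ n, a n ∈ Set.range r ∧ b n ∈ Set.range s) ∧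
    Pairwise fun m n => List.Disjoint (P m).1.support (P n).1.support

/-- A connected digraph with exactly two ends, the ends being the classes of rays under the
equivalence relation `SameEnd`. -/
def IsTwoEnded (Γ : Digraph V) : Prop :=
  Γ.IsConnected ∧
  ∃ r s : ℕ → V, Γ.IsRay r ∧ Γ.IsRay s ∧ ¬ Γ.SameEnd r s ∧
    ∀ t : ℕ → V, Γ.IsRay t → Γ.SameEnd t r ∨ Γ.SameEnd t s

/-! ### The two digraphs on the integers, Property Z -/

/-- The digraph on the integers with arcs `(i, i + 1)`. -/
def directedLine : Digraph ℤ := ⟨fun i j => j = i + 1⟩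

/-- The digraph on the integers with arcs `(i, i + 1)` and `(i + 1, i)`. -/
def bidirectedLine : Digraph ℤ := ⟨fun i j => j = i + 1 ∨ i = j + 1⟩

/-- Property Z: the digraph is connected and has a surjective homomorphism to the directed line. -/
def PropertyZ (Γ : Digraph V) : Prop :=
  Γ.IsConnected ∧ ∃ φ : Γ.Adj →r directedLine.Adj, Function.Surjective φ

/-! ### Local quasi-primitivity -/

/-- The in-neighbours of `v`, with the action of the stabilizer of `v`. -/
def inAction (Γ : Digraph V) (v : V) : SubMulAction (MulAction.stabilizer Γ.Aut v) V where
  carrier := Γ.inSet v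
  smul_mem' g x hx := by
    have h : Γ.Adj (g.1 x) (g.1 v) := g.1.map_rel_iff.2 hx
    rwa [show g.1 v = v from g.2] at h

/-- The out-neighbours of `v`, with the action of the stabilizer of `v`. -/
def outAction (Γ : Digraph V) (v : V) : SubMulAction (MulAction.stabilizer Γ.Aut v) V where
  carrier := Γ.outSet v
  smul_mem' g x hx := by
    have h : Γ.Adj (g.1 v) (g.1 x) := g.1.map_rel_iff.2 hx
    rwa [show g.1 v = v from g.2] at h

/-- Every vertex stabilizer acts quasi-primitively on the in- and on the out-neighbours. -/
def IsLocallyQuasiPrimitive (Γ : Digraph V) : Prop :=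
  ∀ v : V,
    MulAction.IsQuasiPreprimitive (MulAction.stabilizer Γ.Aut v) (Γ.inAction v) ∧
    MulAction.IsQuasiPreprimitive (MulAction.stabilizer Γ.Aut v) (Γ.outAction v)

/-! ### Quotients and subdigraphs -/

/-- The quotient digraph by an equivalence relation on the vertices. -/
def quotient (Γ : Digraph V) (σ : Setoid V) : Digraph (Quotient σ) :=
  ⟨fun A B => ∃ v w : V, Quotient.mk σ v = A ∧ Quotient.mk σ w = B ∧ Γ.Adj v w⟩

/-- The quotient digraph `Γ/N` by the orbits of a group `N` of automorphisms. -/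
def orbitQuotient (Γ : Digraph V) (N : Subgroup Γ.Aut) :
    Digraph (Quotient (MulAction.orbitRel N V)) :=
  Γ.quotient (MulAction.orbitRel N V)

/-- The subdigraph spanned by a set of vertices. -/
def span (Γ : Digraph V) (S : Set V) : Digraph S := ⟨fun u v => Γ.Adj u v⟩

/-- The underlying undirected graph (loops included) is bipartite. -/
def IsBipartite (Γ : Digraph V) : Prop :=
  ∃ c : V → Bool, ∀ u v, Γ.Adj u v → c u ≠ c v

/-! ### The two structural cases -/

/-- Case (i), together with its level function: `N` is a normal subgroup of the automorphism group
`G` with finite orbits on the vertices, `φ` is the quotient map `Γ → Γ/N` followed by an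
isomorphism of `Γ/N` to the bidirected line, and `G/N` is infinite dihedral. -/
structure IsCaseOne (Γ : Digraph V) (N : Subgroup Γ.Aut) (φ : V → ℤ) : Prop where
  [normal : N.Normal]
  finite_orbits : ∀ v : V, (MulAction.orbit N v).Finite
  quotient_iso : ∃ e : (Γ.orbitQuotient N).Iso bidirectedLine,
    ∀ v : V, φ v = e (Quotient.mk (MulAction.orbitRel N V) v)
  group_iso : Nonempty ((Γ.Aut ⧸ N) ≃* DihedralGroup 0)

/-- Case (ii), together with its level function: `N` is a normal subgroup of the automorphism group
`G` with finite orbits on the vertices, `φ` is the quotient map `Γ → Γ/N` followed by an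
isomorphism of `Γ/N` to the directed line, and `G/N` is infinite cyclic. -/
structure IsCaseTwo (Γ : Digraph V) (N : Subgroup Γ.Aut) (φ : V → ℤ) : Prop where
  [normal : N.Normal]
  finite_orbits : ∀ v : V, (MulAction.orbit N v).Finite
  quotient_iso : ∃ e : (Γ.orbitQuotient N).Iso directedLine,
    ∀ v : V, φ v = e (Quotient.mk (MulAction.orbitRel N V) v)
  group_iso : Nonempty ((Γ.Aut ⧸ N) ≃* Multiplicative ℤ)

/-- Case (i) occurs for `Γ`. -/
def CaseOneOccurs (Γ : Digraph V) : Prop := ∃ N φ, Γ.IsCaseOne N φ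

/-- Case (ii) occurs for `Γ`. -/
def CaseTwoOccurs (Γ : Digraph V) : Prop := ∃ N φ, Γ.IsCaseTwo N φ

/-- `N` and `φ` are as in one of the two cases; the levels are the sets `φ ⁻¹' {i}`. -/
def IsLevelMap (Γ : Digraph V) (N : Subgroup Γ.Aut) (φ : V → ℤ) : Prop :=
  Γ.IsCaseOne N φ ∨ Γ.IsCaseTwo N φ

end Digraph

/-! Two inequivalent rays are separated by a set `U` of vertices with finite boundary. In a
vertex-transitive graph with two ends this forces local finiteness (`IsEndPair.neighborSet_finite`).
Any two sets with finite boundary that are infinite and have infinite complement then agree up to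
finitely many vertices and complementation (`IsEndPair.commensurate_or`). So an automorphism `g`
either preserves the class of `U` or exchanges it with that of the complement. The elements of the
first kind form a subgroup `H` of index at most two, on which the signed count `excess (g • U) U` is
additive: it is a translation length, and conjugation by an element outside `H` reverses its sign.
It is nonzero as soon as `g` moves a finite connected set around the boundary of `U` off itself
(`Connected.excess_ne_zero`), so its kernel has finite orbits.

Arc-transitivity turns this length into a height on vertices. If there are reflections, some
reflection fixes a vertex, since otherwise the quotient by the kernel would be cyclic
(`exists_fixing_reflection`). Hence `H` is transitive and the length descends to a function `φ` with
finite levels. All arcs change `φ` by the same amount up to sign, and surjectivity of `φ` makes that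
amount one. The action on heights is infinite dihedral if reflections exist and infinite cyclic
otherwise, giving the two cases.

For the lettered claims the level map is arbitrary. Normality of `N` makes every automorphism act on
levels by `i ↦ c ± i` (`level_affine`). In case (i) arc-transitivity supplies, for each vertex, a
reflection of the levels fixing it (`IsCaseOne.exists_reflection`). The cases exclude each other
even for different `N` (`IsCaseTwo.not_isCaseOne`), so (a) and (b) can be read off from any level
map. Counting arcs between two levels gives (c). The hypotheses of (d) to (g) all contradict case
(i), and in case (ii) the level map itself witnesses Property Z. -/

section

open Filter Pointwise

/-! ### Rays, ends and cuts with finite boundary -/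

namespace SimpleGraph

variable {V : Type*}

/-- The vertices outside `U` with a neighbour in `U`. -/
def outerBoundary (X : SimpleGraph V) (U : Set V) : Set V := {v | v ∉ U ∧ ∃ u ∈ U, X.Adj u v}

/-- A one-way infinite path. -/
def IsRay (X : SimpleGraph V) (r : ℕ → V) : Prop :=
  Function.Injective r ∧ ∀ n, X.Adj (r n) (r (n + 1))

/-- Equivalence of rays: there are infinitely many disjoint paths from one to the other. -/
def SameEnd (X : SimpleGraph V) (r s : ℕ → V) : Prop :=
  ∃ (a b : ℕ → V) (P : ∀ n, X.Path (a n) (b n)),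
    (∀ n, a n ∈ Set.range r ∧ b n ∈ Set.range s) ∧
    Pairwise fun m n => List.Disjoint (P m).1.support (P n).1.support

variable {X : SimpleGraph V} {U F : Set V} {r s t : ℕ → V}

theorem exists_mem_support_outerBoundary {u v : V} (p : X.Walk u v) (hu : u ∈ U) (hv : v ∉ U) :
    ∃ z ∈ p.support, z ∈ X.outerBoundary U := by
  obtain ⟨d, hd, h1, h2⟩ := p.exists_boundary_dart U hu hv
  exact ⟨d.snd, p.dart_snd_mem_support_of_mem_darts hd, h2, d.fst, h1, d.adj⟩

theorem IsRay.eventually_notMem (hr : X.IsRay r) (hF : F.Finite) : ∀ᶠ n in atTop, r n ∉ F := by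
  rw [← Nat.cofinite_eq_atTop]
  exact hr.1.tendsto_cofinite.eventually hF.eventually_cofinite_notMem

theorem IsRay.eventually_mem_or (hr : X.IsRay r) (hU : (X.outerBoundary U).Finite) :
    (∀ᶠ n in atTop, r n ∈ U) ∨ ∀ᶠ n in atTop, r n ∉ U := by
  obtain ⟨N, hN⟩ := eventually_atTop.1 (hr.eventually_notMem hU)
  by_cases h : ∃ m, N ≤ m ∧ r m ∈ U
  · obtain ⟨m, hm, hmU⟩ := h
    left
    refine eventually_atTop.2 ⟨m, fun n hn => ?_⟩
    induction n, hn using Nat.le_induction with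
    | base => exact hmU
    | succ n hn ih =>
      by_contra hc
      exact hN (n + 1) (by omega) ⟨hc, r n, ih, hr.2 n⟩
  · push Not at h
    exact Or.inr (eventually_atTop.2 ⟨N, h⟩)

/-- Among infinitely many disjoint paths, only finitely many can have an end on the wrong side of
the cut or meet its finite boundary; any other path would cross from `U` to its complement without
touching the boundary. -/
theorem not_sameEnd_of_eventually_mem (hU : (X.outerBoundary U).Finite)
    (hr : ∀ᶠ n in atTop, r n ∈ U) (hs : ∀ᶠ n in atTop, s n ∉ U) : ¬ X.SameEnd r s := by
  rintro ⟨a, b, P, hab, hP⟩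
  have ha : Function.Injective a := by
    intro m n hmn
    by_contra hne
    exact hP hne (P m).1.start_mem_support (by rw [hmn]; exact (P n).1.start_mem_support)
  have hb : Function.Injective b := by
    intro m n hmn
    by_contra hne
    exact hP hne (P m).1.end_mem_support (by rw [hmn]; exact (P n).1.end_mem_support)
  rw [← Nat.cofinite_eq_atTop] at hr hs
  have h1 : ∀ᶠ n in cofinite, a n ∈ U := by
    have hfin : (r '' {n | ¬ r n ∈ U}).Finite := Set.Finite.image _ hr
    filter_upwards [ha.tendsto_cofinite.eventually hfin.eventually_cofinite_notMem] with n hn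
    obtain ⟨i, hi⟩ := (hab n).1
    by_contra hc
    exact hn ⟨i, by rwa [Set.mem_ofPred_eq, hi], hi⟩
  have h2 : ∀ᶠ n in cofinite, b n ∉ U := by
    have hfin : (s '' {n | ¬ s n ∉ U}).Finite := Set.Finite.image _ hs
    filter_upwards [hb.tendsto_cofinite.eventually hfin.eventually_cofinite_notMem] with n hn
    obtain ⟨i, hi⟩ := (hab n).2
    by_contra hc
    exact hn ⟨i, by simpa [hi] using hc, hi⟩
  have h3 : ∀ᶠ n in cofinite, ∀ f ∈ X.outerBoundary U, f ∉ (P n).1.support := by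
    refine (eventually_all_finite hU).2 fun f _ => ?_
    refine Set.Subsingleton.finite ?_
    intro m hm n hn
    simp only [Set.mem_compl_iff, Set.mem_ofPred_eq, not_not] at hm hn
    by_contra hne
    exact hP hne hm hn
  obtain ⟨n, hn1, hn2, hn3⟩ := (h1.and (h2.and h3)).exists
  obtain ⟨z, hz, hzU⟩ := exists_mem_support_outerBoundary (P n).1 hn1 hn2
  exact hn3 z hzU hz

/-- Either some finite `F` meets every walk between the rays, and `U` is what can be reached from
`r` while avoiding `F`, or disjoint paths can be chosen greedily, each avoiding the supports of
those before it. -/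
theorem exists_cut_of_not_sameEnd (hr : X.IsRay r) (hrs : ¬ X.SameEnd r s) :
    ∃ U : Set V, (X.outerBoundary U).Finite ∧ (∀ᶠ n in atTop, r n ∈ U) ∧ ∀ n, s n ∉ U := by
  classical
  by_cases h : ∃ F : Finset V, ∀ i j, ∀ p : X.Walk (r i) (s j), ∃ x ∈ p.support, x ∈ F
  · obtain ⟨F, hF⟩ := h
    refine ⟨{v | ∃ n, ∃ p : X.Walk (r n) v, ∀ x ∈ p.support, x ∉ F},
      F.finite_toSet.subset ?_, ?_, ?_⟩
    · rintro v ⟨hv, u, ⟨n, p, hp⟩, huv⟩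
      by_contra hvF
      refine hv ⟨n, p.concat huv, fun x hx => ?_⟩
      rw [Walk.support_concat] at hx
      simp only [List.mem_append, List.mem_singleton] at hx
      rcases hx with hx | rfl
      · exact hp x hx
      · exact hvF
    · filter_upwards [hr.eventually_notMem F.finite_toSet] with n hn
      exact ⟨n, .nil, by simpa using hn⟩
    · rintro j ⟨i, p, hp⟩
      obtain ⟨x, hx, hxF⟩ := hF i j p
      exact hp x hx hxF
  · exfalso
    push Not at h
    apply hrs
    let α := Σ i j : ℕ, X.Path (r i) (s j)
    let R : α → α → Prop := fun x y => List.Disjoint x.2.2.1.support y.2.2.1.support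
    have hsymm : Std.Symm R := ⟨fun x y hxy => List.Disjoint.symm hxy⟩
    obtain ⟨f, -, hf⟩ := exists_seq_of_forall_finset_exists' (fun _ : α => True) R (fun S _ => by
      obtain ⟨i, j, p, hp⟩ := h (S.biUnion fun x => x.2.2.1.support.toFinset)
      refine ⟨⟨i, j, p.toPath⟩, trivial, fun x hx v hv hv' => ?_⟩
      refine hp v (p.support_bypass_subset_support hv') ?_
      simp only [Finset.mem_biUnion, List.mem_toFinset]
      exact ⟨x, hx, hv⟩)
    exact ⟨fun n => r (f n).1, fun n => s (f n).2.1, fun n => (f n).2.2,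
      fun n => ⟨⟨_, rfl⟩, ⟨_, rfl⟩⟩, hf⟩

/-- Greedy construction: of the infinitely many neighbours of the current vertex, only finitely many
lie outside `U` or have been used. Thus with infinite valencies a cut needs only to be nonempty to
contain a ray. -/
theorem exists_isRay_of_infinite_degree (hdeg : ∀ v, (X.neighborSet v).Infinite)
    (hU : (X.outerBoundary U).Finite) (hne : U.Nonempty) :
    ∃ r, X.IsRay r ∧ ∀ n, r n ∈ U := by
  classical
  have step : ∀ x : Finset V × U, ∃ u : U, X.Adj x.2 u ∧ (u : V) ∉ x.1 := by
    rintro ⟨S, u⟩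
    obtain ⟨v, hv, hvS⟩ := ((hdeg u).sdiff (hU.union S.finite_toSet)).nonempty
    simp only [Set.mem_union, not_or] at hvS
    refine ⟨⟨v, ?_⟩, hv, hvS.2⟩
    by_contra hc
    exact hvS.1 ⟨hc, u, u.2, hv⟩
  choose f hf hfS using step
  let x : ℕ → Finset V × U := fun n =>
    Nat.rec ({hne.some}, ⟨hne.some, hne.some_mem⟩) (fun _ y => (insert ↑(f y) y.1, f y)) n
  have hx : ∀ n, x (n + 1) = (insert ↑(f (x n)) (x n).1, f (x n)) := fun n => rfl
  have hmem : ∀ n, ((x n).2 : V) ∈ (x n).1 := by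
    intro n
    cases n with
    | zero => simp [x]
    | succ n => rw [hx]; simp
  have hmono : Monotone fun n => (x n).1 :=
    monotone_nat_of_le_succ fun n => by
      rw [hx]
      exact Finset.subset_insert _ _
  have hlt : ∀ m n, m < n → ((x m).2 : V) ≠ (x n).2 := by
    intro m n hmn h
    obtain ⟨k, rfl⟩ : ∃ k, n = k + 1 := ⟨n - 1, by omega⟩
    refine hfS (x k) ?_
    have h3 : ((x m).2 : V) ∈ (x k).1 := hmono (show m ≤ k by omega) (hmem m)
    rw [h, hx] at h3
    exact h3
  refine ⟨fun n => (x n).2, ⟨fun m n hmn => ?_, fun n => ?_⟩, fun n => (x n).2.2⟩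
  · rcases lt_trichotomy m n with h | h | h
    · exact absurd hmn (hlt m n h)
    · exact h
    · exact absurd hmn.symm (hlt n m h)
  · exact hf (x n)

theorem Connected.exists_adj_dist_eq (hX : X.Connected) {x b : V} (hne : x ≠ b) :
    ∃ y, X.Adj x y ∧ X.dist x b = X.dist y b + 1 := by
  obtain ⟨p, hp⟩ := hX.exists_walk_length_eq_dist x b
  cases p with
  | nil => exact absurd rfl hne
  | @cons _ y _ h q =>
    refine ⟨y, h, le_antisymm ?_ ?_⟩
    · have := hX.dist_triangle (u := x) (v := y) (w := b)
      have h1 := dist_eq_one_iff_adj.2 h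
      omega
    · have := dist_le q
      rw [Walk.length_cons] at hp
      omega

/-- König's lemma, for an infinite set of vertices with finite boundary. -/
theorem exists_isRay_of_infinite (hX : X.Connected) (hdeg : ∀ v, (X.neighborSet v).Finite)
    (hU : (X.outerBoundary U).Finite) (hinf : U.Infinite) :
    ∃ r, X.IsRay r ∧ ∀ᶠ n in atTop, r n ∈ U := by
  classical
  obtain ⟨o, -⟩ := hinf.nonempty
  -- The vertices of `U` that some geodesic from `o` reaches through `x`. The ray is grown along
  -- vertices for which this set is infinite.
  let T : V → Set V := fun x => {b ∈ U | X.dist o b = X.dist o x + X.dist x b}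
  have step : ∀ x : {x // (T x).Infinite}, ∃ y : {x // (T x).Infinite},
      X.Adj x y ∧ X.dist o y = X.dist o x + 1 := by
    rintro ⟨x, hx⟩
    have hsub : T x \ {x} ⊆ ⋃ y ∈ X.neighborSet x, {b ∈ T y | X.dist o y = X.dist o x + 1} := by
      rintro b ⟨⟨hbU, hb⟩, hbx⟩
      obtain ⟨y, hy, hyb⟩ := hX.exists_adj_dist_eq (Ne.symm hbx)
      have h1 := dist_eq_one_iff_adj.2 hy
      have h2 := hX.dist_triangle (u := o) (v := x) (w := y)
      have h3 := hX.dist_triangle (u := o) (v := y) (w := b)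
      simp only [Set.mem_iUnion]
      exact ⟨y, hy, ⟨hbU, by omega⟩, by omega⟩
    have hinf' := (hx.sdiff (Set.finite_singleton x)).mono hsub
    obtain ⟨y, hy, hyinf⟩ : ∃ y ∈ X.neighborSet x,
        {b ∈ T y | X.dist o y = X.dist o x + 1}.Infinite := by
      by_contra! hc
      exact hinf' ((hdeg x).biUnion fun y hy => Set.not_infinite.1 (by simpa using hc y hy))
    obtain ⟨b, -, hb⟩ := hyinf.nonempty
    exact ⟨⟨y, hyinf.mono fun _ h => h.1⟩, hy, hb⟩
  choose f hf hfd using step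
  have hTo : (T o).Infinite := hinf.mono fun b hb => ⟨hb, by simp⟩
  let x : ℕ → {x // (T x).Infinite} := fun n => Nat.rec ⟨o, hTo⟩ (fun _ y => f y) n
  have hx : ∀ n, x (n + 1) = f (x n) := fun n => rfl
  have hd : ∀ n, X.dist o (x n).1 = n := by
    intro n
    induction n with
    | zero => simp [x]
    | succ n ih => rw [hx, hfd, ih]
  refine ⟨fun n => (x n).1, ⟨fun m n hmn => ?_, fun n => ?_⟩, ?_⟩
  · rw [← hd m, ← hd n]
    exact congrArg _ hmn
  · exact hf (x n)
  -- A ray vertex outside `U` at distance above `M` would have a geodesic to some `b ∈ T` crossing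
  -- the boundary at `z`; passing through `z` would then make `b` too close to `o`.
  · obtain ⟨M, hM⟩ := (hU.image (X.dist o)).bddAbove
    refine eventually_atTop.2 ⟨M + 1, fun n hn => ?_⟩
    by_contra hc
    obtain ⟨b, hbU, hb⟩ := (x n).2.nonempty
    obtain ⟨p, hp⟩ := hX.exists_walk_length_eq_dist (x n).1 b
    obtain ⟨z, hz, hzU⟩ := exists_mem_support_outerBoundary p.reverse hbU hc
    rw [Walk.support_reverse, List.mem_reverse] at hz
    have h1 : X.dist z b ≤ p.length := (dist_le (p.dropUntil z hz)).trans (p.length_dropUntil_le_length hz)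
    have h2 := hX.dist_triangle (u := o) (v := z) (w := b)
    have h3 := hM ⟨z, hzU, rfl⟩
    have h4 := hd n
    omega

end SimpleGraph

/-! ### Local finiteness of vertex-transitive graphs with two ends -/

namespace SimpleGraph

variable {V : Type*} {X : SimpleGraph V} {r s t : ℕ → V} {U B S F C D E P Q : Set V}

/-- Two inequivalent rays which represent all ends. -/
structure IsEndPair (X : SimpleGraph V) (r s : ℕ → V) : Prop where
  left : X.IsRay r
  right : X.IsRay s
  not_sameEnd : ¬ X.SameEnd r s
  sameEnd_or : ∀ t, X.IsRay t → X.SameEnd t r ∨ X.SameEnd t s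

theorem IsEndPair.eventually_or (h : X.IsEndPair r s) (hU : (X.outerBoundary U).Finite)
    (ht : X.IsRay t) (htU : ∀ᶠ n in atTop, t n ∈ U) :
    (∀ᶠ n in atTop, r n ∈ U) ∨ ∀ᶠ n in atTop, s n ∈ U := by
  rcases h.sameEnd_or t ht with h1 | h1
  · rcases h.left.eventually_mem_or hU with h2 | h2
    · exact .inl h2
    · exact absurd h1 (not_sameEnd_of_eventually_mem hU htU h2)
  · rcases h.right.eventually_mem_or hU with h2 | h2
    · exact .inr h2
    · exact absurd h1 (not_sameEnd_of_eventually_mem hU htU h2)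

theorem mem_of_preconnected_induce (hB : (X.induce B).Preconnected)
    (h : ∀ u ∈ B, ∀ v ∈ B, X.Adj u v → u ∈ S → v ∈ S) {u v : V} (hu : u ∈ B) (hv : v ∈ B)
    (huS : u ∈ S) : v ∈ S := by
  obtain ⟨p⟩ := hB ⟨u, hu⟩ ⟨v, hv⟩
  by_contra hvS
  obtain ⟨d, -, h1, h2⟩ := p.exists_boundary_dart (Subtype.val ⁻¹' S) huS hvS
  exact h2 (h _ d.fst.2 _ d.snd.2 d.adj h1)

theorem Connected.mem_of_adj_closed (hX : X.Connected) (h : ∀ u v, X.Adj u v → u ∈ S → v ∈ S)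
    {u : V} (hu : u ∈ S) (v : V) : v ∈ S := by
  obtain ⟨p⟩ := hX.preconnected u v
  by_contra hvS
  obtain ⟨d, -, h1, h2⟩ := p.exists_boundary_dart S hu hvS
  exact h2 (h _ _ d.adj h1)

theorem Connected.exists_finite_preconnected (hX : X.Connected) (hF : F.Finite) :
    ∃ B : Set V, B.Finite ∧ F ⊆ B ∧ B.Nonempty ∧ (X.induce B).Preconnected := by
  classical
  obtain ⟨o⟩ := hX.nonempty
  obtain ⟨B, hB, hc⟩ := extend_finset_to_connected hX.preconnected
    (t := insert o hF.toFinset) (Finset.insert_nonempty _ _)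
  refine ⟨B, B.finite_toSet, fun x hx => hB (by simp [hx]), ⟨o, hB (by simp)⟩, hc.preconnected⟩

/-- `F` separates `C` from `D`. -/
structure IsSeparation (X : SimpleGraph V) (F C D : Set V) : Prop where
  cover : ∀ v, v ∈ C ∨ v ∈ F ∨ v ∈ D
  disjCF : ∀ v, v ∈ C → v ∉ F
  disjCD : ∀ v, v ∈ C → v ∉ D
  disjDF : ∀ v, v ∈ D → v ∉ F
  not_adj : ∀ u v, u ∈ C → v ∈ D → ¬ X.Adj u v

theorem IsSeparation.symm (h : X.IsSeparation F C D) : X.IsSeparation F D C where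
  cover v := by have := h.cover v; tauto
  disjCF := h.disjDF
  disjCD v hv hv' := h.disjCD v hv' hv
  disjDF := h.disjCF
  not_adj u v hu hv huv := h.not_adj v u hv hu huv.symm

theorem IsSeparation.mem_or (h : X.IsSeparation F C D) {u v : V} (huv : X.Adj u v) (hu : u ∈ C) :
    v ∈ C ∨ v ∈ F := by
  have := h.cover v
  have := h.not_adj u v hu
  tauto

theorem IsSeparation.outerBoundary_subset (h : X.IsSeparation F C D) : X.outerBoundary C ⊆ F := by
  rintro v ⟨hv, u, hu, huv⟩
  exact (h.mem_or huv hu).resolve_left hv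

theorem IsSeparation.subset_or (h : X.IsSeparation F C D) (hE : (X.induce E).Preconnected)
    (hEF : ∀ v ∈ E, v ∉ F) : E ⊆ C ∨ E ⊆ D := by
  by_cases hne : ∃ u ∈ E, u ∈ C
  · obtain ⟨u, hu, huC⟩ := hne
    left
    intro v hv
    refine mem_of_preconnected_induce hE (fun a _ b hb hab haC => ?_) hu hv huC
    exact (h.mem_or hab haC).resolve_right (hEF b hb)
  · right
    intro v hv
    have := h.cover v
    have := hEF v hv
    by_contra hc
    exact hne ⟨v, hv, by tauto⟩

/-- The hypothesis `hray` holds when all valencies are infinite: nonempty sets with finite boundary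
contain a tail of `r` or `s`. If `F` lay in `Q`, then `C ∩ P` would be closed under adjacency. The
set `D ∩ P` has finite boundary but contains neither tail, so it is empty. -/
theorem IsSeparation.subset_and_disjoint (hX : X.Connected) (hF : F.Finite) (hE : E.Finite)
    (hFne : F.Nonempty) (hFc : (X.induce F).Preconnected)
    (hray : ∀ U : Set V, (X.outerBoundary U).Finite → U.Nonempty →
      (∀ᶠ n in atTop, r n ∈ U) ∨ ∀ᶠ n in atTop, s n ∈ U)
    (h : X.IsSeparation F C D) (h' : X.IsSeparation E P Q) (hED : E ⊆ D)
    (hrC : ∀ᶠ n in atTop, r n ∈ C) (hrP : ∀ᶠ n in atTop, r n ∈ P)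
    (hsQ : ∀ᶠ n in atTop, s n ∈ Q) :
    F ⊆ P ∧ ∀ v, v ∈ D → v ∉ P := by
  have hFE : ∀ v ∈ F, v ∉ E := fun v hv hvE => h.disjDF v (hED hvE) hv
  have hFP : F ⊆ P := by
    refine (h'.subset_or hFc hFE).resolve_right fun hFQ => ?_
    obtain ⟨n, hn1, hn2⟩ := (hrC.and hrP).exists
    obtain ⟨f, hf⟩ := hFne
    refine h.disjCF f (hX.mem_of_adj_closed (S := C ∩ P) ?_ ⟨hn1, hn2⟩ f).1 hf
    rintro u v huv ⟨hu, hu'⟩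
    have h1 := h.mem_or huv hu
    have h2 := h'.mem_or huv hu'
    rcases h1 with h1 | h1
    · refine ⟨h1, h2.resolve_right fun hvE => h.disjCD v h1 (hED hvE)⟩
    · rcases h2 with h2 | h2
      · exact absurd (hFQ h1) (h'.disjCD v h2)
      · exact absurd h2 (hFE v h1)
  refine ⟨hFP, fun v hvD hvP => ?_⟩
  have hb : (X.outerBoundary (D ∩ P)).Finite := by
    refine (hF.union hE).subset ?_
    rintro w ⟨hw, u, ⟨hu, hu'⟩, huw⟩
    have h1 := h.symm.mem_or huw hu
    have h2 := h'.mem_or huw hu'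
    by_contra hc
    simp only [Set.mem_union, not_or] at hc
    exact hw ⟨by tauto, by tauto⟩
  rcases hray _ hb ⟨v, hvD, hvP⟩ with h1 | h1
  · obtain ⟨n, hn1, hn2⟩ := (hrC.and h1).exists
    exact h.disjCD _ hn1 hn2.1
  · obtain ⟨n, hn1, hn2⟩ := (hsQ.and h1).exists
    exact h'.disjCD _ hn2.2 hn1

section Action

variable {G : Type*} [Group G] [MulAction G V]

/-- Neumann's lemma on moving a finite set off another one. -/
theorem exists_smul_disjoint (horb : ∀ v : V, (MulAction.orbit G v).Infinite)
    (hF : F.Finite) (hE : E.Finite) : ∃ g : G, ∀ v ∈ g • F, v ∉ E := by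
  classical
  by_contra! hc
  -- If no translate of `F` avoids `E`, the group is a finite union of cosets of point stabilizers,
  -- so one stabilizer has finite index, against the infinite orbits. The value `1` for pairs in
  -- different orbits is never relied on.
  let c : V × V → G := fun p => if h : ∃ g : G, g • p.1 = p.2 then h.choose else 1
  have hcov : ⋃ p ∈ hF.toFinset ×ˢ hE.toFinset,
      c p • (MulAction.stabilizer G p.1 : Set G) = Set.univ := by
    refine Set.eq_univ_of_forall fun g => ?_
    obtain ⟨v, hv, hvE⟩ := hc g
    obtain ⟨f, hf, rfl⟩ := hv
    simp only [Set.mem_iUnion]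
    refine ⟨(f, g • f), by simp only [Finset.mem_product, Set.Finite.mem_toFinset]; exact ⟨hf, hvE⟩,
      ?_⟩
    have hex : ∃ k : G, k • f = g • f := ⟨g, rfl⟩
    have hck : c (f, g • f) • f = g • f := by
      simp only [c, dif_pos hex]
      exact hex.choose_spec
    rw [Set.mem_smul_set_iff_inv_smul_mem]
    change (c (f, g • f))⁻¹ * g ∈ MulAction.stabilizer G f
    rw [MulAction.mem_stabilizer_iff, mul_smul, inv_smul_eq_iff, hck]
  obtain ⟨p, -, hp⟩ := Subgroup.exists_finiteIndex_of_leftCoset_cover hcov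
  refine horb p.1 (Set.finite_of_ncard_ne_zero ?_)
  rw [← MulAction.index_stabilizer]
  exact hp.index_ne_zero

variable (hadj : ∀ (g : G) (u v : V), X.Adj u v → X.Adj (g • u) (g • v))
include hadj

theorem preconnected_induce_smul (hB : (X.induce B).Preconnected) (g : G) :
    (X.induce (g • B)).Preconnected := by
  rintro ⟨_, u, hu, rfl⟩ ⟨_, v, hv, rfl⟩
  let f : X.induce B →g X.induce (g • B) :=
    ⟨fun x => ⟨g • x.1, Set.smul_mem_smul_set x.2⟩, fun {a b} hab => hadj g _ _ hab⟩
  exact (hB ⟨u, hu⟩ ⟨v, hv⟩).map f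

theorem IsSeparation.smul (h : X.IsSeparation F C D) (g : G) :
    X.IsSeparation (g • F) (g • C) (g • D) where
  cover v := by simpa only [Set.mem_smul_set_iff_inv_smul_mem] using h.cover _
  disjCF v := by simpa only [Set.mem_smul_set_iff_inv_smul_mem] using h.disjCF _
  disjCD v := by simpa only [Set.mem_smul_set_iff_inv_smul_mem] using h.disjCD _
  disjDF v := by simpa only [Set.mem_smul_set_iff_inv_smul_mem] using h.disjDF _
  not_adj u v hu hv huv := by
    rw [Set.mem_smul_set_iff_inv_smul_mem] at hu hv
    exact h.not_adj _ _ hu hv (hadj _ _ _ huv)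

theorem IsSeparation.eventually_smul (hF : F.Finite) (h : X.IsSeparation F C D)
    (hray : ∀ U : Set V, (X.outerBoundary U).Finite → U.Nonempty →
      (∀ᶠ n in atTop, r n ∈ U) ∨ ∀ᶠ n in atTop, s n ∈ U)
    (hC : C.Nonempty) (hD : D.Nonempty) (g : G) :
    ((∀ᶠ n in atTop, r n ∈ g • C) ∧ ∀ᶠ n in atTop, s n ∈ g • D) ∨
      ((∀ᶠ n in atTop, r n ∈ g • D) ∧ ∀ᶠ n in atTop, s n ∈ g • C) := by
  have h' := h.smul hadj g
  have hC' := hray _ ((hF.smul_set (a := g)).subset h'.outerBoundary_subset) (hC.smul_set (a := g))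
  have hD' := hray _ ((hF.smul_set (a := g)).subset h'.symm.outerBoundary_subset)
    (hD.smul_set (a := g))
  have key : ∀ x : ℕ → V, ¬ ((∀ᶠ n in atTop, x n ∈ g • C) ∧ ∀ᶠ n in atTop, x n ∈ g • D) := by
    rintro x ⟨h1, h2⟩
    obtain ⟨n, hn1, hn2⟩ := (h1.and h2).exists
    exact h'.disjCD _ hn1 hn2
  have := key r
  have := key s
  tauto

/-- Otherwise every translate of `F` disjoint from `F` lies in `C`. Take `F`, `g • F`, `k • F`
pairwise disjoint: each lies on the `C`-side of the others. Whichever end `g • C` contains, this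
contradicts the nesting in `subset_and_disjoint`. -/
theorem IsSeparation.exists_smul_subset (hX : X.Connected) (hF : F.Finite) (hFne : F.Nonempty)
    (hFc : (X.induce F).Preconnected) (h : X.IsSeparation F C D)
    (hray : ∀ U : Set V, (X.outerBoundary U).Finite → U.Nonempty →
      (∀ᶠ n in atTop, r n ∈ U) ∨ ∀ᶠ n in atTop, s n ∈ U)
    (horb : ∀ v : V, (MulAction.orbit G v).Infinite)
    (hrC : ∀ᶠ n in atTop, r n ∈ C) (hsD : ∀ᶠ n in atTop, s n ∈ D) :
    ∃ g : G, g • F ⊆ D := by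
  by_contra! hc
  have hC : ∀ g : G, (∀ v ∈ g • F, v ∉ F) → g • F ⊆ C := fun g hg =>
    (h.subset_or (preconnected_induce_smul hadj hFc g) hg).resolve_right (hc g)
  obtain ⟨g, hg⟩ := exists_smul_disjoint horb hF hF
  obtain ⟨k, hk⟩ := exists_smul_disjoint horb hF (hF.union (hF.smul_set (a := g)))
  have hgC := hC g hg
  have hkC := hC k fun v hv hvF => hk v hv (.inl hvF)
  have hF' : F ⊆ g • C := by
    rw [Set.subset_smul_set_iff]
    refine hC g⁻¹ fun v hv hvF => ?_
    rw [Set.mem_smul_set_iff_inv_smul_mem, inv_inv] at hv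
    exact hg _ (Set.smul_mem_smul_set hvF) hv
  have hkgC : k • F ⊆ g • C := by
    rw [Set.subset_smul_set_iff, ← mul_smul]
    refine hC _ fun v hv hvF => ?_
    rw [mul_smul, Set.mem_smul_set_iff_inv_smul_mem, inv_inv] at hv
    exact hk _ hv (.inr (Set.smul_mem_smul_set hvF))
  have hne : ∀ {x : ℕ → V} {A : Set V}, (∀ᶠ n in atTop, x n ∈ A) → A.Nonempty := fun hx => by
    obtain ⟨n, hn⟩ := hx.exists
    exact ⟨_, hn⟩
  have hray' : ∀ U : Set V, (X.outerBoundary U).Finite → U.Nonempty →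
      (∀ᶠ n in atTop, s n ∈ U) ∨ ∀ᶠ n in atTop, r n ∈ U := fun U h1 h2 => (hray U h1 h2).symm
  have h' := h.smul hadj g
  obtain ⟨f, hf⟩ := hFne
  rcases h.eventually_smul hadj hF hray (hne hrC) (hne hsD) g with ⟨h1, h2⟩ | ⟨h1, h2⟩
  · have h3 := (h.symm.subset_and_disjoint hX hF (hF.smul_set (a := g)) ⟨f, hf⟩ hFc hray' h'.symm
      hgC hsD h2 h1).1
    exact h'.disjCD f (hF' hf) (h3 hf)
  · have h3 := (h.symm.subset_and_disjoint hX hF (hF.smul_set (a := g)) ⟨f, hf⟩ hFc hray' h'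
      hgC hsD h2 h1).2
    exact h3 _ (hkC (Set.smul_mem_smul_set hf)) (hkgC (Set.smul_mem_smul_set hf))

/-- A translate of `F` inside `D` has a side `P` containing `F` and disjoint from `D`, so a
neighbour of `F` in `D` must lie in the translate itself. Used on both sides of `F`, this bounds the
whole neighbourhood. -/
theorem IsSeparation.exists_neighborSet_subset (hX : X.Connected) (hF : F.Finite)
    (hFne : F.Nonempty) (hFc : (X.induce F).Preconnected) (h : X.IsSeparation F C D)
    (hray : ∀ U : Set V, (X.outerBoundary U).Finite → U.Nonempty →
      (∀ᶠ n in atTop, r n ∈ U) ∨ ∀ᶠ n in atTop, s n ∈ U)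
    (horb : ∀ v : V, (MulAction.orbit G v).Infinite)
    (hrC : ∀ᶠ n in atTop, r n ∈ C) (hsD : ∀ᶠ n in atTop, s n ∈ D) :
    ∃ E : Set V, E.Finite ∧ ∀ x ∈ F, ∀ v, X.Adj x v → v ∈ C ∨ v ∈ E := by
  obtain ⟨g, hg⟩ := h.exists_smul_subset hadj hX hF hFne hFc hray horb hrC hsD
  refine ⟨F ∪ g • F, hF.union hF.smul_set, fun x hx v hv => ?_⟩
  have h' := h.smul hadj g
  have hne : ∀ {x : ℕ → V} {A : Set V}, (∀ᶠ n in atTop, x n ∈ A) → A.Nonempty := fun hx => by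
    obtain ⟨n, hn⟩ := hx.exists
    exact ⟨_, hn⟩
  obtain ⟨P, Q, hPQ, h1, h2⟩ : ∃ P Q, X.IsSeparation (g • F) P Q ∧
      (∀ᶠ n in atTop, r n ∈ P) ∧ ∀ᶠ n in atTop, s n ∈ Q := by
    rcases h.eventually_smul hadj hF hray (hne hrC) (hne hsD) g with ⟨h1, h2⟩ | ⟨h1, h2⟩
    · exact ⟨_, _, h', h1, h2⟩
    · exact ⟨_, _, h'.symm, h1, h2⟩
  obtain ⟨h3, h4⟩ := h.subset_and_disjoint hX hF hF.smul_set hFne hFc hray hPQ hg hrC h1 h2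
  have h5 := h.cover v
  have h6 := h4 v
  rcases hPQ.mem_or hv (h3 hx) with h7 | h7
  · simp only [Set.mem_union]; tauto
  · exact .inr (.inr h7)

/-- A vertex-transitive connected graph with two ends is locally finite. -/
theorem IsEndPair.neighborSet_finite [MulAction.IsPretransitive G V] (hX : X.Connected)
    (h : X.IsEndPair r s) (v : V) : (X.neighborSet v).Finite := by
  by_contra hv
  have hdeg : ∀ w, (X.neighborSet w).Infinite := by
    intro w
    obtain ⟨g, rfl⟩ := MulAction.exists_smul_eq G v w
    refine (Set.Infinite.image (MulAction.injective g).injOn hv).mono ?_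
    rintro _ ⟨u, hu, rfl⟩
    exact hadj g _ _ hu
  have hray : ∀ U : Set V, (X.outerBoundary U).Finite → U.Nonempty →
      (∀ᶠ n in atTop, r n ∈ U) ∨ ∀ᶠ n in atTop, s n ∈ U := fun U hU hne => by
    obtain ⟨t, ht, htU⟩ := exists_isRay_of_infinite_degree hdeg hU hne
    exact h.eventually_or hU ht (.of_forall htU)
  have horb : ∀ v : V, (MulAction.orbit G v).Infinite := fun v => by
    rw [MulAction.orbit_eq_univ]
    exact (Set.infinite_range_of_injective h.left.1).mono (Set.subset_univ _)
  obtain ⟨U, hU, hrU, hsU⟩ := exists_cut_of_not_sameEnd h.left h.not_sameEnd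
  obtain ⟨F, hF, hUF, hFne, hFc⟩ := hX.exists_finite_preconnected hU
  have hsep : X.IsSeparation F (U \ F) (U ∪ F)ᶜ := by
    refine ⟨fun v => ?_, fun v hv => hv.2, fun v hv hv' => hv' (.inl hv.1),
      fun v hv hv' => hv (.inr hv'), fun u v hu hv huv => hv (.inr (hUF ⟨fun h => hv (.inl h), u, hu.1, huv⟩))⟩
    simp only [Set.mem_sdiff, Set.mem_compl_iff, Set.mem_union]
    tauto
  have hr : ∀ᶠ n in atTop, r n ∈ U \ F := hrU.and (h.left.eventually_notMem hF)
  have hs : ∀ᶠ n in atTop, s n ∈ (U ∪ F)ᶜ := by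
    filter_upwards [h.right.eventually_notMem hF] with n hn
    simp [hn, hsU n]
  obtain ⟨E, hE, h1⟩ := hsep.exists_neighborSet_subset hadj hX hF hFne hFc hray horb hr hs
  obtain ⟨E', hE', h2⟩ := hsep.symm.exists_neighborSet_subset hadj hX hF hFne hFc
    (fun U h1 h2 => (hray U h1 h2).symm) horb hs hr
  obtain ⟨f, hf⟩ := hFne
  refine hdeg f ((hE.union hE').subset fun w hw => ?_)
  have h3 := h1 f hf w hw
  have h4 := h2 f hf w hw
  have h5 := hsep.disjCD w
  simp only [Set.mem_union]
  tauto

end Action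

end SimpleGraph

/-! ### Commensurate cuts and the translation length -/

namespace SimpleGraph

variable {V : Type*} {X : SimpleGraph V} {r s : ℕ → V} {A A' B C U : Set V}

/-- Two sets which differ by finitely many elements. -/
def Commensurate (A B : Set V) : Prop := (A \ B).Finite ∧ (B \ A).Finite

theorem Commensurate.symm (h : Commensurate A B) : Commensurate B A := ⟨h.2, h.1⟩

theorem Commensurate.trans (h : Commensurate A B) (h' : Commensurate B C) : Commensurate A C :=
  ⟨(h.1.union h'.1).subset fun x hx => by
      simp only [Set.mem_union, Set.mem_sdiff] at hx ⊢; tauto,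
    (h.2.union h'.2).subset fun x hx => by
      simp only [Set.mem_union, Set.mem_sdiff] at hx ⊢; tauto⟩

theorem Commensurate.compl (h : Commensurate A B) : Commensurate Aᶜ Bᶜ :=
  ⟨by rw [compl_sdiff_compl]; exact h.2, by rw [compl_sdiff_compl]; exact h.1⟩

theorem Commensurate.infinite (h : Commensurate A B) (hB : B.Infinite) : (B ∩ A).Infinite :=
  fun hf => hB (by rw [← Set.inter_union_sdiff B A]; exact hf.union h.2)

/-- The signed number of elements by which `A` exceeds `B`. -/
noncomputable def excess (A B : Set V) : ℤ := ((A \ B).ncard : ℤ) - (B \ A).ncard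

theorem excess_compl : excess Aᶜ Bᶜ = -excess A B := by
  simp only [excess, compl_sdiff_compl]
  ring

theorem excess_comm : excess A B = -excess B A := by
  simp only [excess]
  ring

/-- Inside one finite window the excess is a difference of two counts, so sums of excesses
telescope. -/
theorem excess_eq_of_subset {T : Set V} (hT : T.Finite) (h1 : A \ B ⊆ T) (h2 : B \ A ⊆ T) :
    excess A B = ((A ∩ T).ncard : ℤ) - (B ∩ T).ncard := by
  have hA : (A ∩ T).ncard = (A ∩ B ∩ T).ncard + (A \ B).ncard := by
    rw [← Set.ncard_union_eq ?_ (hT.subset Set.inter_subset_right) (hT.subset h1)]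
    · congr 1
      ext x
      have := @h1 x
      simp only [Set.mem_union, Set.mem_sdiff, Set.mem_inter_iff] at this ⊢
      tauto
    · rw [Set.disjoint_left]
      exact fun x hx hx' => hx'.2 hx.1.2
  have hB : (B ∩ T).ncard = (A ∩ B ∩ T).ncard + (B \ A).ncard := by
    rw [← Set.ncard_union_eq ?_ (hT.subset Set.inter_subset_right) (hT.subset h2)]
    · congr 1
      ext x
      have := @h2 x
      simp only [Set.mem_union, Set.mem_sdiff, Set.mem_inter_iff] at this ⊢
      tauto
    · rw [Set.disjoint_left]
      exact fun x hx hx' => hx'.2 hx.1.1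
  rw [excess, hA, hB]
  push_cast
  ring

theorem excess_add (h : Commensurate A B) (h' : Commensurate B C) :
    excess A B + excess B C = excess A C := by
  have hT := (h.1.union h.2).union (h'.1.union h'.2)
  rw [excess_eq_of_subset hT (fun x hx => .inl (.inl hx)) (fun x hx => .inl (.inr hx)),
    excess_eq_of_subset hT (fun x hx => .inr (.inl hx)) (fun x hx => .inr (.inr hx)),
    excess_eq_of_subset hT]
  · ring
  · intro x hx
    simp only [Set.mem_union, Set.mem_sdiff] at hx ⊢
    tauto
  · intro x hx
    simp only [Set.mem_union, Set.mem_sdiff] at hx ⊢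
    tauto

theorem finite_outerBoundary_compl (hdeg : ∀ v, (X.neighborSet v).Finite)
    (hU : (X.outerBoundary U).Finite) : (X.outerBoundary Uᶜ).Finite := by
  refine (hU.biUnion fun v _ => hdeg v).subset ?_
  rintro v ⟨hv, u, hu, huv⟩
  simp only [Set.mem_iUnion]
  exact ⟨u, ⟨hu, v, not_not.1 hv, huv.symm⟩, huv⟩

theorem finite_outerBoundary_inter (hA : (X.outerBoundary A).Finite)
    (hB : (X.outerBoundary B).Finite) : (X.outerBoundary (A ∩ B)).Finite := by
  refine (hA.union hB).subset ?_
  rintro v ⟨hv, u, hu, huv⟩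
  by_cases h : v ∈ A
  · exact .inr ⟨fun hB => hv ⟨h, hB⟩, u, hu.2, huv⟩
  · exact .inl ⟨h, u, hu.1, huv⟩

/-- Any two cuts with infinite sides are commensurate up to complementation. -/
theorem IsEndPair.commensurate_or (hX : X.Connected) (h : X.IsEndPair r s)
    (hdeg : ∀ v, (X.neighborSet v).Finite)
    (hU : (X.outerBoundary U).Finite) (hA : (X.outerBoundary A).Finite)
    (hU1 : U.Infinite) (hU2 : Uᶜ.Infinite) (hA1 : A.Infinite) (hA2 : Aᶜ.Infinite) :
    Commensurate A U ∨ Commensurate A Uᶜ := by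
  have key : ∀ W : Set V, (X.outerBoundary W).Finite → W.Infinite →
      (∀ᶠ n in atTop, r n ∈ W) ∨ ∀ᶠ n in atTop, s n ∈ W := fun W h1 h2 => by
    obtain ⟨t, ht, htW⟩ := exists_isRay_of_infinite hX hdeg h1 h2
    exact h.eventually_or h1 ht htW
  have hU' := finite_outerBoundary_compl hdeg hU
  have hA' := finite_outerBoundary_compl hdeg hA
  have excl : ∀ (t : ℕ → V) (W : Set V), (∀ᶠ n in atTop, t n ∈ W) →
      (∀ᶠ n in atTop, t n ∈ Wᶜ) → False := fun t W h1 h2 => by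
    obtain ⟨n, hn1, hn2⟩ := (h1.and h2).exists
    exact hn2 hn1
  have sub : ∀ (t : ℕ → V) (W Z : Set V), (∀ᶠ n in atTop, t n ∈ W ∩ Z) →
      (∀ᶠ n in atTop, t n ∈ W) ∧ ∀ᶠ n in atTop, t n ∈ Z := fun t W Z => eventually_and.1
  have fin : ∀ W Z : Set V, (X.outerBoundary W).Finite → (X.outerBoundary Z).Finite →
      ¬ ((∀ᶠ n in atTop, r n ∈ W) ∧ ∀ᶠ n in atTop, r n ∈ Z) →
      ¬ ((∀ᶠ n in atTop, s n ∈ W) ∧ ∀ᶠ n in atTop, s n ∈ Z) → (W ∩ Z).Finite := by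
    intro W Z hW hZ h1 h2
    by_contra hc
    rcases key _ (finite_outerBoundary_inter hW hZ) hc with h3 | h3
    · exact h1 (sub _ _ _ h3)
    · exact h2 (sub _ _ _ h3)
  have ends : ∀ W : Set V, (X.outerBoundary W).Finite → W.Infinite → Wᶜ.Infinite →
      ((∀ᶠ n in atTop, r n ∈ W) ∧ ∀ᶠ n in atTop, s n ∈ Wᶜ) ∨
        ((∀ᶠ n in atTop, s n ∈ W) ∧ ∀ᶠ n in atTop, r n ∈ Wᶜ) := by
    intro W hW h1 h2
    rcases key W hW h1 with h3 | h3 <;>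
      rcases key Wᶜ (finite_outerBoundary_compl hdeg hW) h2 with h4 | h4
    · exact (excl r W h3 h4).elim
    · exact .inl ⟨h3, h4⟩
    · exact .inr ⟨h3, h4⟩
    · exact (excl s W h3 h4).elim
  have comm : ∀ W Z : Set V, Commensurate W Z ↔ (W ∩ Zᶜ).Finite ∧ (Wᶜ ∩ Z).Finite := by
    intro W Z
    rw [Commensurate, Set.sdiff_eq, Set.sdiff_eq, Set.inter_comm Z]
  rw [comm, comm, compl_compl]
  rcases ends A hA hA1 hA2 with ⟨a1, a2⟩ | ⟨a1, a2⟩ <;>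
    rcases ends U hU hU1 hU2 with ⟨u1, u2⟩ | ⟨u1, u2⟩
  · exact .inl ⟨fin _ _ hA hU' (fun h => excl _ _ u1 h.2) (fun h => excl _ _ h.1 a2),
      fin _ _ hA' hU (fun h => excl _ _ a1 h.1) (fun h => excl _ _ h.2 u2)⟩
  · exact .inr ⟨fin _ _ hA hU (fun h => excl _ _ h.2 u2) (fun h => excl _ _ h.1 a2),
      fin _ _ hA' hU' (fun h => excl _ _ a1 h.1) (fun h => excl _ _ u1 h.2)⟩
  · exact .inr ⟨fin _ _ hA hU (fun h => excl _ _ h.1 a2) (fun h => excl _ _ h.2 u2),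
      fin _ _ hA' hU' (fun h => excl _ _ u1 h.2) (fun h => excl _ _ a1 h.1)⟩
  · exact .inl ⟨fin _ _ hA hU' (fun h => excl _ _ h.1 a2) (fun h => excl _ _ u1 h.2),
      fin _ _ hA' hU (fun h => excl _ _ h.2 u2) (fun h => excl _ _ a1 h.1)⟩

/-- No edge leaves `A ∩ A'`, so by connectedness it is empty or everything. -/
theorem Connected.inter_eq_empty (hX : X.Connected) (hA : A ≠ Set.univ)
    (h : ∀ u v, X.Adj u v → u ∈ A → v ∉ A → u ∉ A')
    (h' : ∀ u v, X.Adj u v → u ∈ A' → v ∉ A' → u ∉ A) : A ∩ A' = ∅ := by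
  by_contra hne
  obtain ⟨x, hx⟩ := Set.nonempty_iff_ne_empty.2 hne
  refine hA (Set.eq_univ_of_forall fun v => (hX.mem_of_adj_closed (S := A ∩ A') ?_ hx v).1)
  rintro u v huv ⟨hu, hu'⟩
  by_contra hc
  by_cases hv : v ∈ A
  · exact h' u v huv hu' (fun hv' => hc ⟨hv, hv'⟩) hu
  · exact h u v huv hu hv hu'

/-- Two commensurate cuts whose boundaries lie in disjoint connected sets are strictly nested. -/
theorem Connected.excess_ne_zero {B' : Set V} (hX : X.Connected)
    (hU1 : U.Infinite) (hU2 : Uᶜ.Infinite)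
    (hA : Commensurate A U) (hBc : (X.induce B).Preconnected) (hBc' : (X.induce B').Preconnected)
    (hU : X.outerBoundary U ⊆ B) (hU' : X.outerBoundary Uᶜ ⊆ B)
    (hAB : X.outerBoundary A ⊆ B') (hAB' : X.outerBoundary Aᶜ ⊆ B')
    (hdisj : ∀ v ∈ B', v ∉ B) : excess A U ≠ 0 := by
  have hUc : ∀ u v, X.Adj u v → u ∈ U → v ∉ U → u ∈ B ∧ v ∈ B := fun u v huv hu hv =>
    ⟨hU' ⟨not_not.2 hu, v, hv, huv.symm⟩, hU ⟨hv, u, hu, huv⟩⟩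
  have hAc : ∀ u v, X.Adj u v → u ∈ A → v ∉ A → u ∈ B' ∧ v ∈ B' := fun u v huv hu hv =>
    ⟨hAB' ⟨not_not.2 hu, v, hv, huv.symm⟩, hAB ⟨hv, u, hu, huv⟩⟩
  have split : ∀ {B W : Set V}, (X.induce B).Preconnected →
      (∀ u ∈ B, ∀ v ∈ B, X.Adj u v → u ∈ W → v ∈ W) → (∀ v ∈ B, v ∈ W) ∨ ∀ v ∈ B, v ∉ W := by
    intro B W hB hW
    by_contra! hc
    obtain ⟨⟨v, hv, hvW⟩, u, hu, huW⟩ := hc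
    exact hvW (mem_of_preconnected_induce hB hW hu hv huW)
  have hBA := split (W := A) hBc fun u hu v hv huv huA => by
    by_contra hvA
    exact hdisj _ (hAc u v huv huA hvA).1 hu
  have hBU := split (W := U) hBc' fun u hu v hv huv huU => by
    by_contra hvU
    exact hdisj _ hu (hUc u v huv huU hvU).1
  have hUne : U ≠ Set.univ := by
    rintro rfl
    simp at hU2
  have hUcne : Uᶜ ≠ Set.univ := by
    intro hc
    rw [Set.compl_univ_iff] at hc
    simp [hc] at hU1
  obtain ⟨u, v, huv, hu, hv⟩ : ∃ u v, X.Adj u v ∧ u ∈ U ∧ v ∉ U := by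
    by_contra! hc
    obtain ⟨x, hx⟩ := hU1.nonempty
    exact hUne (Set.eq_univ_of_forall fun v => hX.mem_of_adj_closed hc hx v)
  obtain ⟨huB, hvB⟩ := hUc u v huv hu hv
  -- Each connected set lies wholly on one side of the other cut. Two of the four positions make `A`
  -- and `U`, or their complements, disjoint, which commensurability forbids; the other two are
  -- strict inclusions.
  rcases hBA with hBA | hBA <;> rcases hBU with hBU | hBU
  · exfalso
    have := hX.inter_eq_empty (A := Uᶜ) (A' := Aᶜ) hUcne
      (fun a b hab ha hb hn => hn (hBA _ (hUc b a hab.symm (not_not.1 hb) ha).2))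
      (fun a b hab ha hb hn => hn (hBU _ (hAc b a hab.symm (not_not.1 hb) ha).2))
    exact (hA.compl.infinite hU2) (by simp [this])
  · have hemp := hX.inter_eq_empty (A := U) (A' := Aᶜ) hUne
      (fun a b hab ha hb hn => hn (hBA _ (hUc a b hab ha hb).1))
      (fun a b hab ha hb hn => hBU _ (hAc b a hab.symm (not_not.1 hb) ha).2 hn)
    have h1 : U \ A = ∅ := hemp
    have h2 : 0 < (A \ U).ncard := (Set.ncard_pos hA.1).2 ⟨v, hBA v hvB, hv⟩
    rw [excess, h1, Set.ncard_empty]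
    omega
  · have hemp := hX.inter_eq_empty (A := Uᶜ) (A' := A) hUcne
      (fun a b hab ha hb hn => hBA _ (hUc b a hab.symm (not_not.1 hb) ha).2 hn)
      (fun a b hab ha hb hn => hn (hBU _ (hAc a b hab ha hb).1))
    have h1 : A \ U = ∅ := by rw [Set.sdiff_eq, Set.inter_comm]; exact hemp
    have h2 : 0 < (U \ A).ncard := (Set.ncard_pos hA.2).2 ⟨u, hu, hBA u huB⟩
    rw [excess, h1, Set.ncard_empty]
    omega
  · exfalso
    have := hX.inter_eq_empty (A := U) (A' := A) hUne
      (fun a b hab ha hb => hBA _ (hUc a b hab ha hb).1)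
      (fun a b hab ha hb => hBU _ (hAc a b hab ha hb).1)
    exact (hA.infinite hU1) (by simp [this])

theorem Connected.finite_setOf_dist_le (hX : X.Connected) (hdeg : ∀ v, (X.neighborSet v).Finite)
    (v : V) (n : ℕ) : {w | X.dist w v ≤ n}.Finite := by
  induction n with
  | zero =>
    refine (Set.finite_singleton v).subset fun w hw => ?_
    exact hX.dist_eq_zero_iff.1 (Nat.le_zero.1 hw)
  | succ n ih =>
    refine ((ih.biUnion fun u _ => hdeg u).union (Set.finite_singleton v)).subset fun w hw => ?_
    by_cases hwv : w = v
    · exact .inr hwv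
    · left
      obtain ⟨y, hy, hyd⟩ := hX.exists_adj_dist_eq hwv
      simp only [Set.mem_iUnion]
      rw [Set.mem_ofPred_eq] at hw
      exact ⟨y, show X.dist y v ≤ n by omega, hy.symm⟩

section Action

variable {G : Type*} [Group G] [MulAction G V]

theorem Commensurate.smul (h : Commensurate A B) (g : G) : Commensurate (g • A) (g • B) := by
  constructor
  · rw [← Set.smul_set_sdiff]
    exact h.1.smul_set
  · rw [← Set.smul_set_sdiff]
    exact h.2.smul_set

theorem excess_smul (g : G) : excess (g • A) (g • B) = excess A B := by
  simp only [excess, ← Set.smul_set_sdiff, Set.ncard_smul_set]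

variable (G) in
/-- The stabilizer of a commensurability class of subsets. -/
def commStabilizer (U : Set V) : Subgroup G where
  carrier := {g | Commensurate (g • U) U}
  mul_mem' {g h} hg hh := by
    rw [Set.mem_ofPred_eq, mul_smul]
    exact (hh.smul g).trans hg
  one_mem' := by simp [Commensurate]
  inv_mem' {g} hg := by
    have := hg.symm.smul g⁻¹
    rwa [inv_smul_smul] at this

theorem mem_commStabilizer {g : G} : g ∈ commStabilizer G U ↔ Commensurate (g • U) U := .rfl

theorem excess_mul_smul {g h : G} (hg : g ∈ commStabilizer G U) (hh : h ∈ commStabilizer G U) :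
    excess ((g * h) • U) U = excess (g • U) U + excess (h • U) U := by
  rw [mul_smul, ← excess_add (hh.smul g) hg, excess_smul, add_comm]

/-- Passing through `h • g • Uᶜ` and `h • Uᶜ`, the middle term is the excess of complements, hence
negated; the two outer corrections cancel. -/
theorem excess_conj_smul {g h : G} (hg : g ∈ commStabilizer G U)
    (hh : Commensurate (h • U) Uᶜ) :
    excess ((h * g * h⁻¹) • U) U = -excess (g • U) U := by
  have h1 : Commensurate (h⁻¹ • U) Uᶜ := by
    have := (hh.smul h⁻¹).symm.compl
    rwa [inv_smul_smul, Set.smul_set_compl, compl_compl] at this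
  have h2 := (h1.smul g).smul h
  have h3 : Commensurate (h • g • Uᶜ) (h • Uᶜ) := by
    have := hg.compl.smul h
    rwa [← Set.smul_set_compl] at this
  have h4 : Commensurate (h • Uᶜ) U := by
    have := hh.compl
    rwa [← Set.smul_set_compl, compl_compl] at this
  rw [mul_smul, mul_smul, ← excess_add h2 (h3.trans h4), ← excess_add h3 h4, excess_smul,
    excess_smul, excess_smul, Set.smul_set_compl, excess_compl, Set.smul_set_compl]
  have h5 : excess (h • U)ᶜ U = excess Uᶜ (h⁻¹ • U) := by
    rw [← excess_smul h⁻¹, Set.smul_set_compl, inv_smul_smul]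
  rw [h5, excess_comm (A := Uᶜ)]
  ring

variable (hadj : ∀ (g : G) (u v : V), X.Adj u v → X.Adj (g • u) (g • v))
include hadj

theorem outerBoundary_smul_subset (g : G) : X.outerBoundary (g • U) ⊆ g • X.outerBoundary U := by
  rintro v ⟨hv, u, hu, huv⟩
  rw [Set.mem_smul_set_iff_inv_smul_mem] at hv hu ⊢
  exact ⟨hv, _, hu, hadj _ _ _ huv⟩

theorem dist_smul_le (hX : X.Connected) (g : G) (u v : V) : X.dist (g • u) (g • v) ≤ X.dist u v := by
  obtain ⟨p, hp⟩ := hX.exists_walk_length_eq_dist u v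
  let f : X →g X := ⟨fun x => g • x, fun {a b} hab => hadj g _ _ hab⟩
  rw [← hp, ← Walk.length_map f p]
  exact dist_le _

/-- A group acting transitively on the vertices of a connected two-ended graph has a subgroup of
index at most two which acts by translations, and the translation length is proper. -/
theorem IsEndPair.exists_translation [MulAction.IsPretransitive G V] (hX : X.Connected)
    (h : X.IsEndPair r s) : ∃ (H : Subgroup G) (τ : G → ℤ),
      (∀ g h, g ∉ H → h ∉ H → g * h ∈ H) ∧
      (∀ g ∈ H, ∀ h ∈ H, τ (g * h) = τ g + τ h) ∧
      (∀ g ∈ H, ∀ h, h ∉ H → τ (h * g * h⁻¹) = -τ g) ∧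
      (∃ g ∈ H, τ g ≠ 0) ∧
      ∀ v : V, {w | ∃ g ∈ H, τ g = 0 ∧ g • v = w}.Finite := by
  have hdeg := h.neighborSet_finite hadj hX
  obtain ⟨U, hU, hrU, hsU⟩ := exists_cut_of_not_sameEnd h.left h.not_sameEnd
  have hU' := finite_outerBoundary_compl hdeg hU
  have hU1 : U.Infinite := by
    obtain ⟨N, hN⟩ := eventually_atTop.1 hrU
    refine (Set.infinite_range_of_injective
      (h.left.1.comp (add_left_injective N))).mono ?_
    rintro _ ⟨n, rfl⟩
    exact hN _ (Nat.le_add_left _ _)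
  have hU2 : Uᶜ.Infinite :=
    (Set.infinite_range_of_injective h.right.1).mono (by rintro _ ⟨n, rfl⟩; exact hsU n)
  have hor : ∀ g : G, Commensurate (g • U) U ∨ Commensurate (g • U) Uᶜ := fun g => by
    refine h.commensurate_or hX hdeg hU (hU.smul_set.subset (outerBoundary_smul_subset hadj g))
      hU1 hU2 hU1.smul_set ?_
    rw [← Set.smul_set_compl]
    exact hU2.smul_set
  have horb : ∀ v : V, (MulAction.orbit G v).Infinite := fun v => by
    rw [MulAction.orbit_eq_univ]
    exact hU1.mono (Set.subset_univ _)
  have hmul : ∀ g k : G, g ∉ commStabilizer G U → k ∉ commStabilizer G U →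
      g * k ∈ commStabilizer G U := by
    intro g k hg hk
    have hg' := (hor g).resolve_left hg
    have hk' := ((hor k).resolve_left hk).smul g
    rw [mem_commStabilizer, mul_smul]
    refine hk'.trans ?_
    have := hg'.compl
    rwa [← Set.smul_set_compl, compl_compl] at this
  have key : ∀ B : Set V, (X.induce B).Preconnected → X.outerBoundary U ⊆ B →
      X.outerBoundary Uᶜ ⊆ B → ∀ g ∈ commStabilizer G U, (∀ v ∈ g • B, v ∉ B) →
      excess (g • U) U ≠ 0 := by
    intro B hBc hB hB' g hg hgB
    refine hX.excess_ne_zero hU1 hU2 hg hBc (preconnected_induce_smul hadj hBc g) hB hB'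
      ((outerBoundary_smul_subset hadj g).trans (Set.smul_set_mono hB)) ?_ hgB
    rw [← Set.smul_set_compl]
    exact (outerBoundary_smul_subset hadj g).trans (Set.smul_set_mono hB')
  obtain ⟨B, hBf, hBU, -, hBc⟩ := hX.exists_finite_preconnected (hU.union hU')
  have hB1 := Set.subset_union_left.trans hBU
  have hB2 := Set.subset_union_right.trans hBU
  refine ⟨commStabilizer G U, fun g => excess (g • U) U, hmul, fun g hg k hk => excess_mul_smul hg hk,
    fun g hg k hk => excess_conj_smul hg ((hor k).resolve_left hk), ?_, fun v => ?_⟩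
  -- With `B`, `g • B`, `k • B` pairwise disjoint, one of `g`, `k`, `g⁻¹ * k` lies in the index-two
  -- subgroup and still moves `B` off itself.
  · obtain ⟨g, hg⟩ := exists_smul_disjoint horb hBf hBf
    obtain ⟨k, hk⟩ := exists_smul_disjoint horb hBf (hBf.union (hBf.smul_set (a := g)))
    by_cases hgH : g ∈ commStabilizer G U
    · exact ⟨g, hgH, key B hBc hB1 hB2 g hgH hg⟩
    · by_cases hkH : k ∈ commStabilizer G U
      · exact ⟨k, hkH, key B hBc hB1 hB2 k hkH fun v hv hv' => hk v hv (.inl hv')⟩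
      · have hm := hmul _ _ (fun hc => hgH (inv_inv g ▸ inv_mem hc)) hkH
        refine ⟨g⁻¹ * k, hm, key B hBc hB1 hB2 _ hm fun v hv hv' => ?_⟩
        rw [mul_smul, Set.mem_smul_set_iff_inv_smul_mem, inv_inv] at hv
        exact hk _ hv (.inr (Set.smul_mem_smul_set hv'))
  -- Translation length zero forces `g • B` to meet `B`, so `g` moves `v` by at most twice the
  -- radius of `B` around `v`.
  · obtain ⟨M, hM⟩ := (hBf.image fun b => X.dist b v).bddAbove
    refine (hX.finite_setOf_dist_le hdeg v (M + M)).subset ?_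
    rintro _ ⟨g, hg, hg0, rfl⟩
    obtain ⟨w, hw, hwB⟩ : ∃ w ∈ g • B, w ∈ B := by
      by_contra! hc
      exact key B hBc hB1 hB2 g hg hc hg0
    obtain ⟨b, hb, rfl⟩ := hw
    have h1 := hM ⟨b, hb, rfl⟩
    have h2 := hM ⟨_, hwB, rfl⟩
    have h3 := dist_smul_le hadj hX g v b
    have h4 := hX.dist_triangle (u := g • v) (v := g • b) (w := v)
    rw [dist_comm (u := v)] at h3
    simp only [Set.mem_ofPred_eq] at h1 h2 ⊢
    omega

end Action

end SimpleGraph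

/-! ### Translations normalised to unit length -/

namespace SimpleGraph

variable {V : Type*} {X : SimpleGraph V} {r s : ℕ → V} {G : Type*} [Group G] [MulAction G V]

/-- `H` has index at most two in `G` and acts by translations of lengths `τ`, the other elements
act by reflections; the kernel of `τ` has finite orbits. -/
structure IsTranslation (V : Type*) [MulAction G V] (H : Subgroup G) (τ : G → ℤ) : Prop where
  mul_mem : ∀ g h, g ∉ H → h ∉ H → g * h ∈ H
  map_mul : ∀ g ∈ H, ∀ h ∈ H, τ (g * h) = τ g + τ h
  map_conj : ∀ g ∈ H, ∀ h, h ∉ H → τ (h * g * h⁻¹) = -τ g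
  exists_one : ∃ g ∈ H, τ g = 1
  finite_orbits : ∀ v : V, {w | ∃ g ∈ H, τ g = 0 ∧ g • v = w}.Finite

theorem IsEndPair.exists_isTranslation [MulAction.IsPretransitive G V]
    (hadj : ∀ (g : G) (u v : V), X.Adj u v → X.Adj (g • u) (g • v)) (hX : X.Connected)
    (h : X.IsEndPair r s) : ∃ (H : Subgroup G) (τ : G → ℤ), IsTranslation V H τ := by
  obtain ⟨H, τ, h1, h2, h3, ⟨t, ht, ht0⟩, h5⟩ := h.exists_translation hadj hX
  have h_one : τ 1 = 0 := by
    have := h2 1 H.one_mem 1 H.one_mem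
    simpa using this
  have h_inv : ∀ g ∈ H, τ g⁻¹ = -τ g := fun g hg => by
    have := h2 g hg g⁻¹ (H.inv_mem hg)
    rw [mul_inv_cancel, h_one] at this
    omega
  let S : AddSubgroup ℤ :=
    { carrier := {n | ∃ g ∈ H, τ g = n}
      add_mem' := by
        rintro _ _ ⟨g, hg, rfl⟩ ⟨k, hk, rfl⟩
        exact ⟨g * k, H.mul_mem hg hk, h2 g hg k hk⟩
      zero_mem' := ⟨1, H.one_mem, h_one⟩
      neg_mem' := by
        rintro _ ⟨g, hg, rfl⟩
        exact ⟨g⁻¹, H.inv_mem hg, h_inv g hg⟩ }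
  -- The lengths form a subgroup generated by a nonzero `d`; dividing by `d` makes the value one
  -- occur.
  obtain ⟨d, hd⟩ := Int.subgroup_cyclic S
  rw [← AddSubgroup.zmultiples_eq_closure] at hd
  have hmem : ∀ n, (∃ g ∈ H, τ g = n) ↔ d ∣ n := fun n => by
    rw [← Int.mem_zmultiples_iff, ← hd]
    rfl
  have hdvd : ∀ g ∈ H, d ∣ τ g := fun g hg => (hmem _).1 ⟨g, hg, rfl⟩
  have hd0 : d ≠ 0 := by
    rintro rfl
    exact ht0 (zero_dvd_iff.1 (hdvd t ht))
  refine ⟨H, fun g => τ g / d, h1, fun g hg k hk => ?_, fun g hg k hk => ?_, ?_, fun v => ?_⟩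
  · simp only [h2 g hg k hk, Int.add_ediv_of_dvd_left (hdvd g hg)]
  · simp only [h3 g hg k hk, Int.neg_ediv_of_dvd (hdvd g hg)]
  · obtain ⟨g, hg, hgd⟩ := (hmem d).2 dvd_rfl
    exact ⟨g, hg, by simp only [hgd, Int.ediv_self hd0]⟩
  · refine (h5 v).subset ?_
    rintro w ⟨g, hg, hg0, hw⟩
    refine ⟨g, hg, ?_, hw⟩
    rw [← Int.ediv_mul_cancel (hdvd g hg), hg0, zero_mul]

namespace IsTranslation

variable {H : Subgroup G} {τ : G → ℤ}

theorem map_one (hτ : IsTranslation V H τ) : τ 1 = 0 := by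
  have := hτ.map_mul 1 H.one_mem 1 H.one_mem
  simpa using this

theorem map_inv (hτ : IsTranslation V H τ) {g : G} (hg : g ∈ H) : τ g⁻¹ = -τ g := by
  have := hτ.map_mul g hg g⁻¹ (H.inv_mem hg)
  rw [mul_inv_cancel, hτ.map_one] at this
  omega

theorem map_zpow (hτ : IsTranslation V H τ) {g : G} (hg : g ∈ H) (n : ℤ) :
    τ (g ^ n) = n * τ g := by
  have hpow : ∀ n : ℕ, τ (g ^ n) = n * τ g := fun n => by
    induction n with
    | zero => simp [hτ.map_one]
    | succ n ih =>
      rw [pow_succ, hτ.map_mul _ (H.pow_mem hg n) _ hg, ih]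
      push_cast
      ring
  rcases n with n | n
  · simpa using hpow n
  · rw [zpow_negSucc, hτ.map_inv (H.pow_mem hg _), hpow, Int.negSucc_eq]
    push_cast
    ring

theorem inv_notMem (_ : IsTranslation V H τ) {g : G} (hg : g ∉ H) : g⁻¹ ∉ H := fun h =>
  hg (inv_inv g ▸ H.inv_mem h)

theorem mul_notMem (_ : IsTranslation V H τ) {g h : G} (hg : g ∉ H) (hh : h ∈ H) : g * h ∉ H :=
  fun hc => hg ((H.mul_mem_cancel_right hh).1 hc)

theorem conj_mem (hτ : IsTranslation V H τ) {g : G} (hg : g ∈ H) (h : G) : h * g * h⁻¹ ∈ H := by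
  by_cases hh : h ∈ H
  · exact H.mul_mem (H.mul_mem hh hg) (H.inv_mem hh)
  · exact hτ.mul_mem _ _ (hτ.mul_notMem hh hg) (hτ.inv_notMem hh)

/-- The kernel of the translation length. -/
def kernel (hτ : IsTranslation V H τ) : Subgroup G where
  carrier := {g | g ∈ H ∧ τ g = 0}
  mul_mem' {g h} hg hh :=
    ⟨H.mul_mem hg.1 hh.1, by rw [hτ.map_mul g hg.1 h hh.1, hg.2, hh.2, add_zero]⟩
  one_mem' := ⟨H.one_mem, hτ.map_one⟩
  inv_mem' {g} hg := ⟨H.inv_mem hg.1, by rw [hτ.map_inv hg.1, hg.2, neg_zero]⟩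

instance kernel_normal (hτ : IsTranslation V H τ) : hτ.kernel.Normal where
  conj_mem g hg h := by
    refine ⟨hτ.conj_mem hg.1 h, ?_⟩
    by_cases hh : h ∈ H
    · rw [hτ.map_mul _ (H.mul_mem hh hg.1) _ (H.inv_mem hh), hτ.map_mul _ hh _ hg.1,
        hτ.map_inv hh, hg.2]
      ring
    · rw [hτ.map_conj g hg.1 h hh, hg.2, neg_zero]

/-- Translations with a fixed point are trivial. -/
theorem eq_zero_of_smul_eq [Infinite V] [MulAction.IsPretransitive G V]
    (hτ : IsTranslation V H τ) {g : G} (hg : g ∈ H) {v : V} (hv : g • v = v) : τ g = 0 := by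
  by_contra hk
  obtain ⟨t, ht, ht1⟩ := hτ.exists_one
  have hH : {w | ∃ h ∈ H, h • v = w}.Finite := by
    -- Since `g` fixes `v`, dividing `τ h` by `τ g` with remainder `i` moves `h • v` into the kernel
    -- orbit of `t ^ i • v`. The `H`-orbit of `v`, and then the whole vertex set, would be finite.
    refine ((Set.finite_Ico 0 |τ g|).biUnion fun i _ => hτ.finite_orbits (t ^ i • v)).subset ?_
    rintro _ ⟨h, hh, rfl⟩
    simp only [Set.mem_iUnion]
    refine ⟨τ h % τ g, ⟨Int.emod_nonneg _ hk, Int.emod_lt_abs _ hk⟩,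
      h * (g ^ (τ h / τ g))⁻¹ * (t ^ (τ h % τ g))⁻¹,
      H.mul_mem (H.mul_mem hh (H.inv_mem (H.zpow_mem hg _))) (H.inv_mem (H.zpow_mem ht _)), ?_, ?_⟩
    · rw [hτ.map_mul _ (H.mul_mem hh (H.inv_mem (H.zpow_mem hg _))) _ (H.inv_mem (H.zpow_mem ht _)),
        hτ.map_mul _ hh _ (H.inv_mem (H.zpow_mem hg _)), hτ.map_inv (H.zpow_mem hg _),
        hτ.map_inv (H.zpow_mem ht _), hτ.map_zpow hg, hτ.map_zpow ht, ht1]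
      have := Int.emod_add_mul_ediv (τ h) (τ g)
      linarith
    · have hfix : (g ^ (τ h / τ g))⁻¹ • v = v :=
        (MulAction.stabilizer G v).inv_mem ((MulAction.stabilizer G v).zpow_mem hv _)
      rw [mul_smul, inv_smul_smul, mul_smul, hfix]
  by_cases hc : ∃ c, c ∉ H
  · obtain ⟨c, hc⟩ := hc
    refine Set.infinite_univ ((hH.union (hH.smul_set (a := c))).subset fun x _ => ?_)
    obtain ⟨h, rfl⟩ := MulAction.exists_smul_eq G v x
    by_cases hh : h ∈ H
    · exact .inl ⟨h, hh, rfl⟩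
    · right
      rw [Set.mem_smul_set_iff_inv_smul_mem, ← mul_smul]
      exact ⟨_, hτ.mul_mem _ _ (hτ.inv_notMem hc) hh, rfl⟩
  · push Not at hc
    refine Set.infinite_univ (hH.subset fun x _ => ?_)
    obtain ⟨h, rfl⟩ := MulAction.exists_smul_eq G v x
    exact ⟨h, hc h, rfl⟩

end IsTranslation

end SimpleGraph

/-! ### Height functions on the vertices -/

namespace Digraph

variable {V : Type u} {Γ : Digraph V}

theorem smul_adj (g : Γ.Aut) {u v : V} (h : Γ.Adj u v) : Γ.Adj (g • u) (g • v) := g.map_rel_iff.2 h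

theorem inclusive_smul_adj (g : Γ.Aut) (u v : V) (h : Γ.toSimpleGraphInclusive.Adj u v) :
    Γ.toSimpleGraphInclusive.Adj (g • u) (g • v) := by
  refine ⟨fun hc => h.1 (MulAction.injective g hc), ?_⟩
  exact h.2.imp (smul_adj g) (smul_adj g)

theorem IsVertexTransitive.isPretransitive (hv : Γ.IsVertexTransitive) :
    MulAction.IsPretransitive Γ.Aut V := ⟨hv⟩

theorem IsConnected.mem_of_closed (hc : Γ.IsConnected) {S : Set V}
    (h : ∀ u v, Γ.Adj u v → (u ∈ S ↔ v ∈ S)) {u : V} (hu : u ∈ S) (v : V) : v ∈ S := by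
  refine SimpleGraph.Connected.mem_of_adj_closed hc (fun a b hab ha => ?_) hu v
  rcases hab.2 with h1 | h1
  · exact (h a b h1).1 ha
  · exact (h b a h1).2 ha

theorem IsTwoEnded.infinite (h : Γ.IsTwoEnded) : Infinite V := by
  obtain ⟨-, r, s, hr, -⟩ := h
  exact Infinite.of_injective r hr.1

theorem IsTwoEnded.not_adj_self (ha : Γ.IsArcTransitive) (h : Γ.IsTwoEnded) (v : V) :
    ¬ Γ.Adj v v := by
  intro hv
  have := h.infinite
  obtain ⟨w, hw⟩ := exists_ne v
  refine hw (h.1.mem_of_closed (S := {v}) (fun a b hab => ?_) rfl w)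
  obtain ⟨g, h1, h2⟩ := ha v v a b hv hab
  rw [← h1, ← h2]

theorem IsTwoEnded.exists_adj (h : Γ.IsTwoEnded) : ∃ u v, Γ.Adj u v := by
  by_contra! hc
  have := h.infinite
  obtain ⟨u, v, hne⟩ := exists_pair_ne V
  exact hne.symm (h.1.mem_of_closed (S := {u}) (fun a b hab => absurd hab (hc a b)) rfl v)

theorem IsTwoEnded.exists_isEndPair (ha : Γ.IsArcTransitive) (h : Γ.IsTwoEnded) :
    ∃ r s, Γ.toSimpleGraphInclusive.IsEndPair r s := by
  have hloop := h.not_adj_self ha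
  have key : ∀ t, Γ.IsRay t ↔ Γ.toSimpleGraphInclusive.IsRay t := fun t => by
    refine and_congr_right fun ht => forall_congr' fun n => ?_
    exact ⟨fun h => ⟨fun hc => by simpa using ht hc, h⟩, fun h => h.2⟩
  obtain ⟨-, r, s, hr, hs, h1, h2⟩ := h
  exact ⟨r, s, (key r).1 hr, (key s).1 hs, h1, fun t ht => h2 t ((key t).2 ht)⟩

open SimpleGraph

/-- Reflections, if there are any, can be chosen to have a fixed vertex. -/
theorem exists_fixing_reflection (ha : Γ.IsArcTransitive)
    (hc : Γ.IsConnected) [Infinite V] [MulAction.IsPretransitive Γ.Aut V]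
    {H : Subgroup Γ.Aut} {τ : Γ.Aut → ℤ} (hτ : IsTranslation V H τ) {c : Γ.Aut} (hcH : c ∉ H)
    {o v : V} (hov : Γ.Adj o v) : ∃ c ∉ H, c • o = o := by
  by_contra! hfix
  have hstab : ∀ g : Γ.Aut, g • o = o → g ∈ hτ.kernel := fun g hg => by
    have hgH : g ∈ H := by
      by_contra hn
      exact hfix g hn hg
    exact ⟨hgH, hτ.eq_zero_of_smul_eq hgH hg⟩
  have heq : ∀ g k : Γ.Aut, g • o = k • o → (g : Γ.Aut ⧸ hτ.kernel) = k := fun g k hgk => by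
    rw [QuotientGroup.eq]
    exact hstab _ (by rw [mul_smul, ← hgk, inv_smul_smul])
  obtain ⟨a, rfl⟩ := MulAction.exists_smul_eq Γ.Aut o v
  -- The class of `g` modulo the kernel now depends only on `g • o`, and every arc is `(k • o, k • a
  -- • o)`: following it multiplies the class by that of `a`. Connectedness makes the quotient
  -- cyclic.
  have hall := hc.mem_of_closed
    (S := {w | ∃ (g : Γ.Aut) (n : ℤ), g • o = w ∧ (g : Γ.Aut ⧸ hτ.kernel) = (a : Γ.Aut ⧸ hτ.kernel) ^ n})
    (u := o) (fun u w huw => by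
      obtain ⟨k, hk, hk'⟩ := ha _ _ _ _ hov huw
      change k • o = u at hk
      change k • a • o = w at hk'
      rw [← mul_smul] at hk'
      constructor
      · rintro ⟨g, n, hg, hgn⟩
        refine ⟨k * a, n + 1, hk', ?_⟩
        rw [zpow_add_one, ← hgn, heq g k (hg.trans hk.symm)]
        rfl
      · rintro ⟨g, n, hg, hgn⟩
        refine ⟨k, n - 1, hk, ?_⟩
        rw [zpow_sub_one, ← hgn, heq g _ (hg.trans hk'.symm), QuotientGroup.mk_mul,
          mul_inv_cancel_right]) ⟨1, 0, one_smul _ _, by simp⟩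
  have hcyc : ∀ g : Γ.Aut, ∃ n : ℤ, (g : Γ.Aut ⧸ hτ.kernel) = (a : Γ.Aut ⧸ hτ.kernel) ^ n := fun g => by
    obtain ⟨k, n, hk, hkn⟩ := hall (g • o)
    exact ⟨n, by rw [← hkn, heq k g hk]⟩
  obtain ⟨t, ht, ht1⟩ := hτ.exists_one
  obtain ⟨m, hm⟩ := hcyc t
  obtain ⟨n, hn⟩ := hcyc c
  -- A cyclic quotient is abelian, but this commutator has translation length `-2`.
  have hcomm : (c * t * c⁻¹ * t⁻¹ : Γ.Aut) ∈ hτ.kernel := by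
    rw [← QuotientGroup.eq_one_iff]
    simp only [QuotientGroup.mk_mul, QuotientGroup.mk_inv, hm, hn]
    group
  have h2 := hcomm.2
  rw [hτ.map_mul _ (hτ.conj_mem ht c) _ (H.inv_mem ht), hτ.map_conj t ht c hcH, hτ.map_inv ht,
    ht1] at h2
  norm_num at h2

/-- A height function on the vertices: the elements of `H` act as translations, the others as
reflections. -/
structure IsHeight (Γ : Digraph V) (H : Subgroup Γ.Aut) (φ : V → ℤ) (o : V) : Prop where
  base : φ o = 0
  mul_mem : ∀ g h, g ∉ H → h ∉ H → g * h ∈ H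
  smul_of_mem : ∀ g ∈ H, ∀ x, φ (g • x) = φ (g • o) + φ x
  smul_of_notMem : ∀ g, g ∉ H → ∀ x, φ (g • x) = φ (g • o) - φ x
  transitive : ∀ v, ∃ h ∈ H, h • o = v
  surjective : Function.Surjective φ
  finite : ∀ i, (φ ⁻¹' {i}).Finite
  reflection : ∀ g, g ∉ H → ∃ c ∉ H, c • o = o

theorem IsHeight.neg {H : Subgroup Γ.Aut} {φ : V → ℤ} {o : V} (h : Γ.IsHeight H φ o) :
    Γ.IsHeight H (fun v => -φ v) o where
  base := by simp [h.base]
  mul_mem := h.mul_mem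
  smul_of_mem g hg x := by rw [h.smul_of_mem g hg x]; ring
  smul_of_notMem g hg x := by rw [h.smul_of_notMem g hg x]; ring
  transitive := h.transitive
  surjective i := by
    obtain ⟨v, hv⟩ := h.surjective (-i)
    exact ⟨v, by simp [hv]⟩
  finite i := by
    refine (h.finite (-i)).subset fun v hv => ?_
    simp only [Set.mem_preimage, Set.mem_singleton_iff] at hv ⊢
    omega
  reflection := h.reflection

/-- The height of `v` is the length of any translation taking `o` to `v`: one exists after
correcting by a reflection fixing `o`, and the length is well defined because translations with a
fixed point have length zero. -/
theorem exists_isHeight (ha : Γ.IsArcTransitive) (hc : Γ.IsConnected) [Infinite V]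
    [MulAction.IsPretransitive Γ.Aut V] {H : Subgroup Γ.Aut} {τ : Γ.Aut → ℤ}
    (hτ : IsTranslation V H τ) {o v : V} (hov : Γ.Adj o v) : ∃ φ, Γ.IsHeight H φ o := by
  have hrefl : ∀ g, g ∉ H → ∃ c ∉ H, c • o = o := fun g hg =>
    exists_fixing_reflection ha hc hτ hg hov
  have htrans : ∀ v, ∃ h ∈ H, h • o = v := fun v => by
    obtain ⟨g, rfl⟩ := MulAction.exists_smul_eq Γ.Aut o v
    by_cases hg : g ∈ H
    · exact ⟨g, hg, rfl⟩
    · obtain ⟨c, hcH, hco⟩ := hrefl g hg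
      exact ⟨g * c, hτ.mul_mem _ _ hg hcH, by rw [mul_smul, hco]⟩
  choose f hfH hf using htrans
  have hφ : ∀ h ∈ H, ∀ v, h • o = v → τ (f v) = τ h := fun h hh v hv => by
    have h1 : τ (h⁻¹ * f v) = 0 := hτ.eq_zero_of_smul_eq (H.mul_mem (H.inv_mem hh) (hfH v))
      (v := o) (by rw [mul_smul, hf, ← hv, inv_smul_smul])
    rw [hτ.map_mul _ (H.inv_mem hh) _ (hfH v), hτ.map_inv hh] at h1
    omega
  have hmem : ∀ g ∈ H, ∀ x, τ (f (g • x)) = τ (f (g • o)) + τ (f x) := fun g hg x => by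
    rw [hφ g hg (g • o) rfl, hφ (g * f x) (H.mul_mem hg (hfH x)) (g • x) (by rw [mul_smul, hf]),
      hτ.map_mul g hg _ (hfH x)]
  refine ⟨fun v => τ (f v), ?_, hτ.mul_mem, hmem, ?_, fun v => ⟨f v, hfH v, hf v⟩, ?_, ?_, hrefl⟩
  · simp only [hφ 1 H.one_mem o (one_smul _ o), hτ.map_one]
  · intro g hg x
    obtain ⟨c, hcH, hco⟩ := hrefl g hg
    have hci : c⁻¹ • o = o := by rw [inv_smul_eq_iff, hco]
    have h1 : τ (f (c⁻¹ • x)) = -τ (f x) := by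
      have hcinv := hτ.inv_notMem hcH
      rw [hφ (c⁻¹ * f x * c⁻¹⁻¹) (hτ.conj_mem (hfH x) _), hτ.map_conj _ (hfH x) _ hcinv]
      rw [inv_inv, mul_smul, mul_smul, hco, hf]
    have h2 := hmem (g * c) (hτ.mul_mem _ _ hg hcH) (c⁻¹ • x)
    rw [mul_smul, smul_inv_smul, mul_smul, hco, h1] at h2
    simp only [h2]
    ring
  · intro i
    obtain ⟨t, ht, ht1⟩ := hτ.exists_one
    refine ⟨t ^ i • o, ?_⟩
    simp only [hφ _ (H.zpow_mem ht i) _ rfl, hτ.map_zpow ht, ht1, mul_one]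
  · intro i
    by_cases hne : ∃ v, τ (f v) = i
    · obtain ⟨v, hv⟩ := hne
      refine (hτ.finite_orbits v).subset fun w hw => ?_
      refine ⟨f w * (f v)⁻¹, H.mul_mem (hfH w) (H.inv_mem (hfH v)), ?_, ?_⟩
      · rw [hτ.map_mul _ (hfH w) _ (H.inv_mem (hfH v)), hτ.map_inv (hfH v), hv]
        simp only [Set.mem_preimage, Set.mem_singleton_iff] at hw
        omega
      · have : (f v)⁻¹ • v = o := by rw [inv_smul_eq_iff, hf]
        rw [mul_smul, this, hf]
    · convert Set.finite_empty
      ext w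
      simp only [Set.mem_preimage, Set.mem_singleton_iff, Set.mem_empty_iff_false, iff_false]
      exact fun h => hne ⟨w, h⟩

/-- A vertex- and arc-transitive two-ended digraph has a height function for which some arc
goes up by one. -/
theorem exists_isHeight_adj (hv : Γ.IsVertexTransitive) (ha : Γ.IsArcTransitive)
    (h2 : Γ.IsTwoEnded) : ∃ H φ o, Γ.IsHeight H φ o ∧ ∃ v, Γ.Adj o v ∧ φ v = 1 := by
  have := h2.infinite
  have := hv.isPretransitive
  obtain ⟨r, s, hrs⟩ := h2.exists_isEndPair ha
  obtain ⟨H, τ, hτ⟩ := hrs.exists_isTranslation (G := Γ.Aut) inclusive_smul_adj h2.1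
  obtain ⟨o, v, hov⟩ := h2.exists_adj
  obtain ⟨φ, hφ⟩ := exists_isHeight ha h2.1 hτ hov
  -- Every arc is an image of `(o, v)`, so it changes the height by `± φ v`. As the height `1`
  -- occurs, `φ v` is a unit.
  have hdvd : ∀ x, φ v ∣ φ x := by
    refine h2.1.mem_of_closed (S := {x | φ v ∣ φ x}) (u := o) (fun a b hab => ?_) ?_
    · obtain ⟨g, hg1, hg2⟩ := ha _ _ _ _ hov hab
      change g • o = a at hg1
      change g • v = b at hg2
      subst hg1 hg2
      by_cases hgH : g ∈ H
      · simp only [Set.mem_ofPred_eq, hφ.smul_of_mem g hgH v]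
        exact (dvd_add_left dvd_rfl).symm
      · simp only [Set.mem_ofPred_eq, hφ.smul_of_notMem g hgH v]
        exact (dvd_sub_left dvd_rfl).symm
    · simp [hφ.base]
  obtain ⟨x, hx⟩ := hφ.surjective 1
  have h1 := hdvd x
  rw [hx] at h1
  rcases Int.isUnit_iff.1 (isUnit_of_dvd_one h1) with h | h
  · exact ⟨H, φ, o, hφ, v, hov, h⟩
  · exact ⟨H, _, o, hφ.neg, v, hov, by simp [h]⟩

end Digraph

/-! ### Existence of the levels -/

namespace Digraph

variable {V : Type u} {Γ : Digraph V} {H : Subgroup Γ.Aut} {φ : V → ℤ} {o : V}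

theorem exists_orbitQuotient_iso {N : Subgroup Γ.Aut} {L : Digraph ℤ}
    (hs : Function.Surjective φ) (hN : ∀ u v, u ∈ MulAction.orbit N v ↔ φ u = φ v)
    (hhom : ∀ u v, Γ.Adj u v → L.Adj (φ u) (φ v))
    (hlift : ∀ u j, L.Adj (φ u) j → ∃ v, Γ.Adj u v ∧ φ v = j) :
    ∃ e : (Γ.orbitQuotient N).Iso L, ∀ v, φ v = e (Quotient.mk (MulAction.orbitRel N V) v) := by
  let f : Quotient (MulAction.orbitRel N V) → ℤ := Quotient.lift φ fun u v h => (hN u v).1 h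
  have hf : Function.Bijective f := by
    constructor
    · intro a b
      induction a using Quotient.inductionOn
      induction b using Quotient.inductionOn
      exact fun h => Quotient.sound ((hN _ _).2 h)
    · intro i
      obtain ⟨v, hv⟩ := hs i
      exact ⟨Quotient.mk _ v, hv⟩
  refine ⟨⟨Equiv.ofBijective f hf, ?_⟩, fun v => rfl⟩
  intro a b
  constructor
  · induction a using Quotient.inductionOn with | _ u
    induction b using Quotient.inductionOn with | _ w
    intro h
    obtain ⟨v, huv, hv⟩ := hlift u (φ w) h
    exact ⟨u, v, rfl, Quotient.sound ((hN _ _).2 hv), huv⟩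
  · rintro ⟨u, v, rfl, rfl, huv⟩
    exact hhom u v huv

theorem IsHeight.mul_notMem_right (_ : Γ.IsHeight H φ o) {g h : Γ.Aut} (hg : g ∈ H) (hh : h ∉ H) :
    g * h ∉ H := fun hc => hh ((H.mul_mem_cancel_left hg).1 hc)

theorem IsHeight.mul_notMem_left (_ : Γ.IsHeight H φ o) {g h : Γ.Aut} (hg : g ∉ H) (hh : h ∈ H) :
    g * h ∉ H := fun hc => hg ((H.mul_mem_cancel_right hh).1 hc)

open Classical in
/-- The action on the heights. -/
noncomputable def IsHeight.toDihedral (h : Γ.IsHeight H φ o) : Γ.Aut →* DihedralGroup 0 :=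
  MonoidHom.mk'
    (fun g => if g ∈ H then .r (Int.cast (φ (g • o)) : ZMod 0)
      -- The minus sign matches the convention `r i * sr j = sr (j - i)`.
      else .sr (Int.cast (-φ (g • o)) : ZMod 0)) fun g k => by
      by_cases hg : g ∈ H <;> by_cases hk : k ∈ H
      · rw [if_pos hg, if_pos hk, if_pos (H.mul_mem hg hk), DihedralGroup.r_mul_r, mul_smul,
          h.smul_of_mem g hg, Int.cast_add]
      · rw [if_pos hg, if_neg hk, if_neg (h.mul_notMem_right hg hk), DihedralGroup.r_mul_sr,
          mul_smul, h.smul_of_mem g hg]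
        congr 1
        push_cast
        ring
      · rw [if_neg hg, if_pos hk, if_neg (h.mul_notMem_left hg hk), DihedralGroup.sr_mul_r,
          mul_smul, h.smul_of_notMem g hg]
        congr 1
        push_cast
        ring
      · rw [if_neg hg, if_neg hk, if_pos (h.mul_mem g k hg hk), DihedralGroup.sr_mul_sr,
          mul_smul, h.smul_of_notMem g hg]
        congr 1
        push_cast
        ring

theorem IsHeight.mem_ker_toDihedral (h : Γ.IsHeight H φ o) (g : Γ.Aut) :
    g ∈ h.toDihedral.ker ↔ g ∈ H ∧ φ (g • o) = 0 := by
  rw [MonoidHom.mem_ker, IsHeight.toDihedral, MonoidHom.mk'_apply, DihedralGroup.one_def]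
  by_cases hg : g ∈ H
  · rw [if_pos hg, DihedralGroup.r.injEq, Int.cast_eq_zero]
    exact ⟨fun hc => ⟨hg, hc⟩, fun hc => hc.2⟩
  · rw [if_neg hg]
    exact ⟨fun hc => (nomatch hc), fun hc => absurd hc.1 hg⟩

theorem IsHeight.toDihedral_surjective (h : Γ.IsHeight H φ o) {c : Γ.Aut} (hc : c ∉ H) :
    Function.Surjective h.toDihedral := by
  obtain ⟨c, hcH, hco⟩ := h.reflection c hc
  rintro (i | i)
  · obtain ⟨i, rfl⟩ := ZMod.intCast_surjective i
    obtain ⟨v, hv⟩ := h.surjective i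
    obtain ⟨g, hg, rfl⟩ := h.transitive v
    refine ⟨g, ?_⟩
    rw [IsHeight.toDihedral, MonoidHom.mk'_apply, if_pos hg, hv]
  · obtain ⟨i, rfl⟩ := ZMod.intCast_surjective i
    obtain ⟨v, hv⟩ := h.surjective (-i)
    obtain ⟨g, hg, rfl⟩ := h.transitive v
    refine ⟨g * c, ?_⟩
    rw [IsHeight.toDihedral, MonoidHom.mk'_apply, if_neg (h.mul_notMem_right hg hcH), mul_smul,
      hco, hv, neg_neg]

/-- The action on the heights, if there are no reflections. -/
noncomputable def IsHeight.toInt (h : Γ.IsHeight H φ o) (hH : ∀ g, g ∈ H) :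
    Γ.Aut →* Multiplicative ℤ :=
  MonoidHom.mk' (fun g => Multiplicative.ofAdd (φ (g • o))) fun g k => by
    rw [mul_smul, h.smul_of_mem g (hH g), ofAdd_add]

theorem IsHeight.orbit_ker (h : Γ.IsHeight H φ o) {N : Subgroup Γ.Aut}
    (hN : ∀ g, g ∈ N ↔ g ∈ H ∧ φ (g • o) = 0) (u v : V) :
    u ∈ MulAction.orbit N v ↔ φ u = φ v := by
  constructor
  · rintro ⟨⟨g, hg⟩, rfl⟩
    obtain ⟨hgH, hg0⟩ := (hN g).1 hg
    change φ (g • v) = φ v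
    rw [h.smul_of_mem g hgH, hg0, zero_add]
  · intro huv
    obtain ⟨a, haH, rfl⟩ := h.transitive u
    obtain ⟨b, hbH, rfl⟩ := h.transitive v
    refine ⟨⟨a * b⁻¹, (hN _).2 ⟨H.mul_mem haH (H.inv_mem hbH), ?_⟩⟩, ?_⟩
    · have h1 := h.smul_of_mem b hbH (b⁻¹ • o)
      rw [smul_inv_smul, h.base] at h1
      rw [mul_smul, h.smul_of_mem a haH, huv]
      omega
    · change (a * b⁻¹) • b • o = a • o
      rw [mul_smul, inv_smul_smul]

theorem IsHeight.adj_sub (h : Γ.IsHeight H φ o) (ha : Γ.IsArcTransitive) {v : V}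
    (hov : Γ.Adj o v) (hv : φ v = 1) {x y : V} (hxy : Γ.Adj x y) :
    φ y = φ x + 1 ∨ (∃ g, g ∉ H) ∧ φ x = φ y + 1 := by
  obtain ⟨g, hg1, hg2⟩ := ha _ _ _ _ hov hxy
  change g • o = x at hg1
  change g • v = y at hg2
  subst hg1 hg2
  by_cases hgH : g ∈ H
  · left
    rw [h.smul_of_mem g hgH v, hv]
  · right
    refine ⟨⟨g, hgH⟩, ?_⟩
    rw [h.smul_of_notMem g hgH v, hv]
    ring

theorem IsHeight.exists_adj_up (h : Γ.IsHeight H φ o) {v : V}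
    (hov : Γ.Adj o v) (hv : φ v = 1) (x : V) : ∃ y, Γ.Adj x y ∧ φ y = φ x + 1 := by
  obtain ⟨a, haH, rfl⟩ := h.transitive x
  exact ⟨a • v, smul_adj a hov, by rw [h.smul_of_mem a haH v, hv]⟩

theorem IsHeight.exists_adj_down (h : Γ.IsHeight H φ o) {v : V}
    (hov : Γ.Adj o v) (hv : φ v = 1) {c : Γ.Aut} (hc : c ∉ H) (x : V) :
    ∃ y, Γ.Adj x y ∧ φ x = φ y + 1 := by
  obtain ⟨c, hcH, hco⟩ := h.reflection c hc
  obtain ⟨a, haH, rfl⟩ := h.transitive x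
  refine ⟨a • c • v, smul_adj a (hco ▸ smul_adj c hov), ?_⟩
  rw [h.smul_of_mem a haH o, h.smul_of_mem a haH (c • v), h.smul_of_notMem c hcH v, hco, h.base, hv]
  ring

theorem exists_isLevelMap (hv : Γ.IsVertexTransitive) (ha : Γ.IsArcTransitive)
    (h2 : Γ.IsTwoEnded) : ∃ N φ, Γ.IsLevelMap N φ := by
  obtain ⟨H, φ, o, h, v, hov, hv1⟩ := exists_isHeight_adj hv ha h2
  have hfin : ∀ {N : Subgroup Γ.Aut}, (∀ g, g ∈ N ↔ g ∈ H ∧ φ (g • o) = 0) →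
      ∀ v, (MulAction.orbit N v).Finite := fun hN v =>
    (h.finite (φ v)).subset fun u hu => (h.orbit_ker hN u v).1 hu
  by_cases hH : ∃ c, c ∉ H
  · obtain ⟨c, hc⟩ := hH
    have hN := h.mem_ker_toDihedral
    refine ⟨h.toDihedral.ker, φ, .inl ⟨hfin hN, ?_, ?_⟩⟩
    · refine exists_orbitQuotient_iso h.surjective (h.orbit_ker hN) ?_ ?_
      · intro x y hxy
        exact (h.adj_sub ha hov hv1 hxy).imp_right And.right
      · rintro x j (rfl | hj)
        · exact h.exists_adj_up hov hv1 x
        · obtain ⟨y, hxy, hy⟩ := h.exists_adj_down hov hv1 hc x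
          exact ⟨y, hxy, by omega⟩
    · exact ⟨QuotientGroup.quotientKerEquivOfSurjective _ (h.toDihedral_surjective hc)⟩
  · push Not at hH
    have hN : ∀ g, g ∈ (h.toInt hH).ker ↔ g ∈ H ∧ φ (g • o) = 0 := fun g => by
      rw [MonoidHom.mem_ker, IsHeight.toInt, MonoidHom.mk'_apply, ofAdd_eq_one]
      exact ⟨fun h => ⟨hH g, h⟩, fun h => h.2⟩
    refine ⟨(h.toInt hH).ker, φ, .inr ⟨hfin hN, ?_, ?_⟩⟩
    · refine exists_orbitQuotient_iso h.surjective (h.orbit_ker hN) ?_ ?_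
      · intro x y hxy
        rcases h.adj_sub ha hov hv1 hxy with h1 | ⟨⟨g, hg⟩, -⟩
        · exact h1
        · exact absurd (hH g) hg
      · rintro x j rfl
        exact h.exists_adj_up hov hv1 x
    · refine ⟨QuotientGroup.quotientKerEquivOfSurjective _ fun i => ?_⟩
      obtain ⟨v, hv⟩ := h.surjective i.toAdd
      obtain ⟨g, hg, rfl⟩ := h.transitive v
      exact ⟨g, by rw [IsHeight.toInt, MonoidHom.mk'_apply, hv, ofAdd_toAdd]⟩

end Digraph

/-! ### How automorphisms permute the levels of an arbitrary level map -/

theorem Int.affine_of_injective {f : ℤ → ℤ} (hf : Function.Injective f)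
    (h : ∀ i, f (i + 1) = f i + 1 ∨ f i = f (i + 1) + 1) :
    (∃ c, ∀ i, f i = i + c) ∨ ∃ c, ∀ i, f i = c - i := by
  -- Injectivity forbids turning back, so all steps have the same sign.
  have hstep : ∀ i, f (i + 1 + 1) - f (i + 1) = f (i + 1) - f i := fun i => by
    have h1 := h i
    have h2 := h (i + 1)
    have h3 : f (i + 1 + 1) ≠ f i := fun hc => by
      have := hf hc
      omega
    omega
  have hconst : ∀ i, f (i + 1) - f i = f 1 - f 0 := fun i => by
    induction i using Int.induction_on with
    | zero => simp
    | succ i ih => rw [← ih]; exact hstep i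
    | pred i ih =>
      have := hstep (-(i : ℤ) - 1)
      rw [← ih, show -(i : ℤ) - 1 + 1 = -i by ring] at *
      exact this.symm
  have hlin : ∀ i, f i = f 0 + i * (f 1 - f 0) := fun i => by
    induction i using Int.induction_on with
    | zero => simp
    | succ i ih =>
      have := hconst i
      rw [add_mul, ← add_assoc, ← ih]
      omega
    | pred i ih =>
      have := hconst (-(i : ℤ) - 1)
      rw [show -(i : ℤ) - 1 + 1 = -i by ring] at this
      rw [sub_mul]
      omega
  have h0 := h 0
  rw [zero_add] at h0
  rcases h0 with h0 | h0
  · left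
    refine ⟨f 0, fun i => ?_⟩
    rw [hlin, h0]
    ring
  · right
    refine ⟨f 0, fun i => ?_⟩
    rw [hlin, h0]
    ring

namespace Digraph

variable {V : Type u} {Γ : Digraph V} {N N' : Subgroup Γ.Aut} {φ φ' : V → ℤ} {L : Digraph ℤ}

section Quotient

variable {e : (Γ.orbitQuotient N).Iso L}

theorem level_eq_iff (he : ∀ v, φ v = e (Quotient.mk (MulAction.orbitRel N V) v)) (u v : V) :
    φ u = φ v ↔ u ∈ MulAction.orbit N v := by
  rw [he, he, e.injective.eq_iff]
  exact Quotient.eq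

theorem level_surjective (he : ∀ v, φ v = e (Quotient.mk (MulAction.orbitRel N V) v)) :
    Function.Surjective φ := fun i => by
  obtain ⟨a, ha⟩ := e.surjective i
  obtain ⟨v, rfl⟩ := Quotient.exists_rep a
  exact ⟨v, by rw [he, ha]⟩

theorem level_adj (he : ∀ v, φ v = e (Quotient.mk (MulAction.orbitRel N V) v)) {u v : V}
    (h : Γ.Adj u v) : L.Adj (φ u) (φ v) := by
  rw [he, he]
  exact e.map_rel_iff.2 ⟨u, v, rfl, rfl, h⟩

theorem exists_adj_of_level_adj (he : ∀ v, φ v = e (Quotient.mk (MulAction.orbitRel N V) v))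
    {i j : ℤ} (h : L.Adj i j) : ∃ u v, Γ.Adj u v ∧ φ u = i ∧ φ v = j := by
  obtain ⟨x, rfl⟩ := level_surjective he i
  obtain ⟨y, rfl⟩ := level_surjective he j
  have h' := h
  rw [he x, he y] at h'
  obtain ⟨u, v, hu, hv, huv⟩ := e.map_rel_iff.1 h'
  exact ⟨u, v, huv, by rw [he u, hu, ← he], by rw [he v, hv, ← he]⟩

theorem exists_out_of_level_adj (he : ∀ v, φ v = e (Quotient.mk (MulAction.orbitRel N V) v))
    {u : V} {j : ℤ} (h : L.Adj (φ u) j) : ∃ v, Γ.Adj u v ∧ φ v = j := by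
  obtain ⟨x, y, hxy, hx, rfl⟩ := exists_adj_of_level_adj he h
  obtain ⟨n, rfl⟩ := (level_eq_iff he u x).1 hx.symm
  exact ⟨n • y, smul_adj n.1 hxy, (level_eq_iff he _ _).2 ⟨n, rfl⟩⟩

theorem exists_in_of_level_adj (he : ∀ v, φ v = e (Quotient.mk (MulAction.orbitRel N V) v))
    {v : V} {i : ℤ} (h : L.Adj i (φ v)) : ∃ u, Γ.Adj u v ∧ φ u = i := by
  obtain ⟨x, y, hxy, rfl, hy⟩ := exists_adj_of_level_adj he h
  obtain ⟨n, rfl⟩ := (level_eq_iff he v y).1 hy.symm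
  exact ⟨n • x, smul_adj n.1 hxy, (level_eq_iff he _ _).2 ⟨n, rfl⟩⟩

theorem level_smul_eq [N.Normal] (he : ∀ v, φ v = e (Quotient.mk (MulAction.orbitRel N V) v))
    (g : Γ.Aut) {u v : V} (h : φ u = φ v) : φ (g • u) = φ (g • v) := by
  obtain ⟨⟨n, hn⟩, rfl⟩ := (level_eq_iff he u v).1 h
  refine (level_eq_iff he _ _).2 ⟨⟨g * n * g⁻¹, Subgroup.Normal.conj_mem ‹_› n hn g⟩, ?_⟩
  change (g * n * g⁻¹) • g • v = g • n • v
  rw [mul_smul, inv_smul_smul, mul_smul]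

theorem level_finite (hN : ∀ v : V, (MulAction.orbit N v).Finite)
    (he : ∀ v, φ v = e (Quotient.mk (MulAction.orbitRel N V) v)) (i : ℤ) : (φ ⁻¹' {i}).Finite := by
  obtain ⟨v, rfl⟩ := level_surjective he i
  exact (hN v).subset fun u hu => (level_eq_iff he u v).1 hu

/-- By normality `g` permutes the `N`-orbits, and it takes arcs to arcs, so it induces an injection
of the integers sending neighbours to neighbours. -/
theorem level_affine [N.Normal] (he : ∀ v, φ v = e (Quotient.mk (MulAction.orbitRel N V) v))
    (hL : ∀ i j, L.Adj i j → j = i + 1 ∨ i = j + 1) (hL' : ∀ i, L.Adj i (i + 1)) (g : Γ.Aut) :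
    (∃ c, ∀ x, φ (g • x) = φ x + c) ∨ ∃ c, ∀ x, φ (g • x) = c - φ x := by
  choose σ hσ using level_surjective he
  have hf : ∀ x, φ (g • σ (φ x)) = φ (g • x) := fun x => level_smul_eq he g (hσ _)
  have hinj : Function.Injective fun i => φ (g • σ i) := fun i j hij => by
    have h1 := level_smul_eq he g⁻¹ hij
    rwa [inv_smul_smul, inv_smul_smul, hσ, hσ] at h1
  have hstep : ∀ i, φ (g • σ (i + 1)) = φ (g • σ i) + 1 ∨ φ (g • σ i) = φ (g • σ (i + 1)) + 1 := by
    intro i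
    obtain ⟨u, v, huv, hu, hv⟩ := exists_adj_of_level_adj he (hL' i)
    rw [← hv, ← hu, hf, hf]
    exact hL _ _ (level_adj he (smul_adj g huv))
  rcases Int.affine_of_injective hinj hstep with ⟨c, hc⟩ | ⟨c, hc⟩
  · exact .inl ⟨c, fun x => by rw [← hf, hc]⟩
  · exact .inr ⟨c, fun x => by rw [← hf, hc]⟩

end Quotient

/-- The common properties of the level functions of the two cases. -/
structure IsLevelled (Γ : Digraph V) (φ : V → ℤ) : Prop where
  surjective : Function.Surjective φ
  finite : ∀ i, (φ ⁻¹' {i}).Finite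
  adj : ∀ {u v}, Γ.Adj u v → φ v = φ u + 1 ∨ φ u = φ v + 1
  smul_eq : ∀ (g : Γ.Aut) {u v : V}, φ u = φ v → φ (g • u) = φ (g • v)
  affine : ∀ g : Γ.Aut, (∃ c, ∀ x, φ (g • x) = φ x + c) ∨ ∃ c, ∀ x, φ (g • x) = c - φ x
  translate : ∀ u v, ∃ g : Γ.Aut, g • u = v ∧ ∀ x, φ (g • x) = φ x + (φ v - φ u)

theorem IsCaseTwo.isLevelled (h : Γ.IsCaseTwo N φ) (hv : Γ.IsVertexTransitive) :
    Γ.IsLevelled φ := by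
  have := h.normal
  obtain ⟨e, he⟩ := h.quotient_iso
  have haff := level_affine he (fun i j hij => .inl hij) (fun i => rfl)
  refine ⟨level_surjective he, level_finite h.finite_orbits he, fun huv => .inl (level_adj he huv),
    level_smul_eq he, haff, fun u v => ?_⟩
  obtain ⟨g, rfl⟩ := hv u v
  refine ⟨g, rfl, fun x => ?_⟩
  change _ = φ x + (φ (g • u) - φ u)
  rcases haff g with ⟨c, hc⟩ | ⟨c, hc⟩
  · rw [hc, hc]
    ring
  · obtain ⟨a, b, hab, -⟩ := exists_adj_of_level_adj (i := 0) he rfl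
    have h1 : φ b = φ a + 1 := level_adj he hab
    have h2 : φ (g • b) = φ (g • a) + 1 := level_adj he (smul_adj g hab)
    rw [hc, hc] at h2
    omega

theorem IsCaseTwo.adj (h : Γ.IsCaseTwo N φ) {u v : V} (huv : Γ.Adj u v) : φ v = φ u + 1 := by
  obtain ⟨e, he⟩ := h.quotient_iso
  exact level_adj he huv

theorem IsCaseTwo.propertyZ (h : Γ.IsCaseTwo N φ) (hc : Γ.IsConnected) : Γ.PropertyZ := by
  obtain ⟨e, he⟩ := h.quotient_iso
  exact ⟨hc, ⟨φ, fun huv => h.adj huv⟩, level_surjective he⟩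

theorem IsCaseOne.exists_neighbours (h : Γ.IsCaseOne N φ) (v : V) :
    (∃ u ∈ Γ.inSet v, φ u = φ v - 1) ∧ (∃ u ∈ Γ.inSet v, φ u = φ v + 1) ∧
      (∃ w ∈ Γ.outSet v, φ w = φ v - 1) ∧ (∃ w ∈ Γ.outSet v, φ w = φ v + 1) := by
  obtain ⟨e, he⟩ := h.quotient_iso
  refine ⟨exists_in_of_level_adj he (.inl (by ring)), exists_in_of_level_adj he (.inr rfl),
    exists_out_of_level_adj he (.inr (by ring)), exists_out_of_level_adj he (.inl rfl)⟩

/-- Arc-transitivity yields an automorphism taking an out-arc of `v` that goes down to one that goes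
up. It fixes `v`, so it cannot shift the levels. -/
theorem IsCaseOne.exists_reflection (h : Γ.IsCaseOne N φ) (ha : Γ.IsArcTransitive) (v : V) :
    ∃ g : Γ.Aut, g • v = v ∧ ∀ x, φ (g • x) = 2 * φ v - φ x := by
  have := h.normal
  obtain ⟨-, -, ⟨w, hw, hw'⟩, ⟨u, hu, hu'⟩⟩ := h.exists_neighbours v
  obtain ⟨e, he⟩ := h.quotient_iso
  obtain ⟨g, hg, hgw⟩ := ha _ _ _ _ hw hu
  change g • v = v at hg
  change g • w = u at hgw
  refine ⟨g, hg, fun x => ?_⟩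
  rcases level_affine he (fun i j hij => hij) (fun i => .inl rfl) g with ⟨c, hc⟩ | ⟨c, hc⟩
  · have h1 := hc v
    have h2 := hc w
    rw [hg] at h1
    rw [hgw] at h2
    omega
  · have h1 := hc v
    rw [hg] at h1
    rw [hc]
    omega

theorem IsCaseOne.isLevelled (h : Γ.IsCaseOne N φ) (hv : Γ.IsVertexTransitive)
    (ha : Γ.IsArcTransitive) : Γ.IsLevelled φ := by
  have := h.normal
  have hrefl := h.exists_reflection ha
  obtain ⟨e, he⟩ := h.quotient_iso
  have haff := level_affine he (fun i j hij => hij) (fun i => .inl rfl)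
  refine ⟨level_surjective he, level_finite h.finite_orbits he, fun huv => level_adj he huv,
    level_smul_eq he, haff, fun u v => ?_⟩
  obtain ⟨g, hg⟩ := hv u v
  change g • u = v at hg
  rcases haff g with ⟨c, hc⟩ | ⟨c, hc⟩
  · refine ⟨g, hg, fun x => ?_⟩
    rw [← hg, hc, hc]
    ring
  · obtain ⟨k, hk, hk'⟩ := hrefl v
    refine ⟨k * g, by rw [mul_smul, hg, hk], fun x => ?_⟩
    rw [mul_smul, hk', ← hg, hc, hc]
    ring

theorem IsLevelMap.isLevelled (h : Γ.IsLevelMap N φ) (hv : Γ.IsVertexTransitive)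
    (ha : Γ.IsArcTransitive) : Γ.IsLevelled φ :=
  h.elim (·.isLevelled hv ha) (·.isLevelled hv)

/-- The two cases exclude each other. -/
theorem IsCaseTwo.not_isCaseOne (h : Γ.IsCaseTwo N φ) (hv : Γ.IsVertexTransitive)
    (ha : Γ.IsArcTransitive) : ¬ Γ.IsCaseOne N' φ' := by
  intro h'
  have hl := h.isLevelled hv
  have hl' := h'.isLevelled hv ha
  obtain ⟨o, ho⟩ := hl.surjective 0
  obtain ⟨w, hw⟩ := hl.surjective 1
  obtain ⟨t, ht, htx⟩ := hl.translate o w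
  obtain ⟨k, hk, hkx⟩ := h'.exists_reflection ha o
  have htrans : ∀ g : Γ.Aut, ∃ c, ∀ x, φ (g • x) = φ x + c := fun g => by
    refine (hl.affine g).resolve_right ?_
    rintro ⟨c, hc⟩
    obtain ⟨e, he⟩ := h.quotient_iso
    obtain ⟨a, b, hab, -⟩ := exists_adj_of_level_adj (i := 0) he rfl
    have h1 := h.adj hab
    have h2 := h.adj (smul_adj g hab)
    rw [hc, hc] at h2
    omega
  obtain ⟨b, hb⟩ := htrans k
  have hki : ∀ x, φ (k⁻¹ • x) = φ x - b := fun x => by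
    have := hb (k⁻¹ • x)
    rw [smul_inv_smul] at this
    omega
  have hki' : ∀ x, φ' (k⁻¹ • x) = 2 * φ' o - φ' x := fun x => by
    have := hkx (k⁻¹ • x)
    rw [smul_inv_smul] at this
    omega
  obtain ⟨c, hc⟩ : ∃ c, ∀ x, φ' (t • t • x) = φ' x + c := by
    rcases hl'.affine t with ⟨c, hc⟩ | ⟨c, hc⟩
    · exact ⟨c + c, fun x => by rw [hc, hc]; ring⟩
    · exact ⟨0, fun x => by rw [hc, hc]; ring⟩
  -- In the directed levels every automorphism is a shift and `m` shifts by `4`. In the bidirected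
  -- levels `t * t` is a shift, which conjugation by the reflection `k` inverts, so `m` fixes every
  -- level. Its powers would put infinitely many vertices into one finite level.
  let m : Γ.Aut := k * (t * t) * k⁻¹ * (t * t)
  have hm : ∀ x, φ (m • x) = φ x + 4 := fun x => by
    simp only [m, mul_smul, hb, htx, hki, ho, hw]
    ring
  have hm' : ∀ x, φ' (m • x) = φ' x := fun x => by
    simp only [m, mul_smul, hkx, hc, hki']
    ring
  have hmn : ∀ n : ℕ, φ (m ^ n • o) = 4 * n ∧ φ' (m ^ n • o) = φ' o := fun n => by
    induction n with
    | zero => simp only [pow_zero, one_smul, ho]; simp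
    | succ n ih =>
      rw [pow_succ', mul_smul, hm, hm', ih.1, ih.2]
      push_cast
      exact ⟨by ring, rfl⟩
  have hinj : Function.Injective fun n : ℕ => m ^ n • o := fun a b hab => by
    have h1 := (hmn a).1
    have h2 := (hmn b).1
    have h3 := congrArg φ hab
    simp only at h3
    omega
  refine Set.infinite_range_of_injective hinj ((hl'.finite (φ' o)).subset ?_)
  rintro _ ⟨n, rfl⟩
  exact (hmn n).2

/-! ### The subdigraph between two consecutive levels -/

/-- The restriction of an automorphism to an invariant set of vertices. -/
def Aut.restrict {S : Set V} (g : Γ.Aut) (hg : ∀ x, g • x ∈ S ↔ x ∈ S) : (Γ.span S).Aut where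
  toEquiv := g.toEquiv.subtypeEquiv fun x => (hg x).symm
  map_rel_iff' := g.map_rel_iff

theorem Aut.coe_restrict_apply {S : Set V} (g : Γ.Aut) (hg : ∀ x, g • x ∈ S ↔ x ∈ S) (x : S) :
    (g.restrict hg x : V) = g • (x : V) := rfl

theorem mem_levels {i : ℤ} {x : V} : x ∈ φ ⁻¹' {i} ∪ φ ⁻¹' {i + 1} ↔ φ x = i ∨ φ x = i + 1 :=
  .rfl

theorem IsLevelled.span_isBipartite (h : Γ.IsLevelled φ) (i : ℤ) :
    (Γ.span (φ ⁻¹' {i} ∪ φ ⁻¹' {i + 1})).IsBipartite := by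
  refine ⟨fun x => decide (φ x = i), fun x y hxy => ?_⟩
  have hx := mem_levels.1 x.2
  have hy := mem_levels.1 y.2
  have := h.adj hxy
  rw [ne_eq, decide_eq_decide]
  omega

/-- An automorphism taking an arc between the two levels to another such arc preserves or exchanges
these levels, so it restricts. -/
theorem IsLevelled.span_isArcTransitive (h : Γ.IsLevelled φ) (ha : Γ.IsArcTransitive) (i : ℤ) :
    (Γ.span (φ ⁻¹' {i} ∪ φ ⁻¹' {i + 1})).IsArcTransitive := by
  intro x y x' y' hxy hxy'
  obtain ⟨g, hg1, hg2⟩ := ha _ _ _ _ hxy hxy'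
  change g • (x : V) = x' at hg1
  change g • (y : V) = y' at hg2
  refine ⟨Aut.restrict g fun z => ?_, Subtype.ext hg1, Subtype.ext hg2⟩
  have hx := mem_levels.1 x.2
  have hy := mem_levels.1 y.2
  have hx' := mem_levels.1 x'.2
  have hy' := mem_levels.1 y'.2
  have h1 := h.adj hxy
  have h2 := h.adj hxy'
  rw [mem_levels, mem_levels]
  rcases h.affine g with ⟨c, hc⟩ | ⟨c, hc⟩
  · have h3 := hc x
    have h4 := hc y
    have h5 := hc z
    rw [hg1] at h3
    rw [hg2] at h4
    omega
  · have h3 := hc x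
    have h4 := hc y
    have h5 := hc z
    rw [hg1] at h3
    rw [hg2] at h4
    omega

theorem IsCaseOne.span_isVertexTransitive (h : Γ.IsCaseOne N φ) (hv : Γ.IsVertexTransitive)
    (ha : Γ.IsArcTransitive) (i : ℤ) :
    (Γ.span (φ ⁻¹' {i} ∪ φ ⁻¹' {i + 1})).IsVertexTransitive := by
  intro x y
  have hx := mem_levels.1 x.2
  have hy := mem_levels.1 y.2
  obtain ⟨g, hg, hgx⟩ := (h.isLevelled hv ha).translate x y
  by_cases hxy : φ x = φ y
  · refine ⟨Aut.restrict g fun z => ?_, Subtype.ext hg⟩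
    rw [mem_levels, mem_levels, hgx]
    omega
  -- The translation taking `x` to `y` leaves the pair of levels; following it by the reflection at
  -- `y` exchanges the two levels instead.
  · obtain ⟨k, hk, hkx⟩ := h.exists_reflection ha y
    refine ⟨Aut.restrict (k * g) fun z => ?_, Subtype.ext ?_⟩
    · rw [mem_levels, mem_levels, mul_smul, hkx, hgx]
      omega
    · rw [Aut.coe_restrict_apply, mul_smul, hg, hk]

end Digraph

namespace Digraph

variable {V : Type u} {Γ : Digraph V} {N N' : Subgroup Γ.Aut} {φ φ' : V → ℤ}

/-! ### Valencies -/

/-- The out-neighbours of `v` which lie `d` levels above `v`. -/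
def outAt (Γ : Digraph V) (φ : V → ℤ) (v : V) (d : ℤ) : Set V := {w | Γ.Adj v w ∧ φ w = φ v + d}

/-- The in-neighbours of `v` which lie `d` levels above `v`. -/
def inAt (Γ : Digraph V) (φ : V → ℤ) (v : V) (d : ℤ) : Set V := {u | Γ.Adj u v ∧ φ u = φ v + d}

theorem smul_adj_iff (g : Γ.Aut) {u v : V} : Γ.Adj (g • u) (g • v) ↔ Γ.Adj u v := g.map_rel_iff

namespace IsLevelled

theorem finite_outAt (h : Γ.IsLevelled φ) (v : V) (d : ℤ) : (Γ.outAt φ v d).Finite :=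
  (h.finite (φ v + d)).subset fun _ hw => hw.2

theorem finite_inAt (h : Γ.IsLevelled φ) (v : V) (d : ℤ) : (Γ.inAt φ v d).Finite :=
  (h.finite (φ v + d)).subset fun _ hw => hw.2

theorem ncard_outAt_eq (h : Γ.IsLevelled φ) (u v : V) (d : ℤ) :
    (Γ.outAt φ u d).ncard = (Γ.outAt φ v d).ncard := by
  obtain ⟨g, rfl, hg⟩ := h.translate u v
  rw [← Set.ncard_smul_set g]
  congr 1
  ext w
  obtain ⟨w, rfl⟩ := MulAction.surjective g w
  rw [Set.smul_mem_smul_set_iff]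
  simp only [outAt, Set.mem_ofPred_eq, smul_adj_iff, hg w]
  exact and_congr_right fun _ => by omega

theorem ncard_inAt_eq (h : Γ.IsLevelled φ) (u v : V) (d : ℤ) :
    (Γ.inAt φ u d).ncard = (Γ.inAt φ v d).ncard := by
  obtain ⟨g, rfl, hg⟩ := h.translate u v
  rw [← Set.ncard_smul_set g]
  congr 1
  ext w
  obtain ⟨w, rfl⟩ := MulAction.surjective g w
  rw [Set.smul_mem_smul_set_iff]
  simp only [inAt, Set.mem_ofPred_eq, smul_adj_iff, hg w]
  exact and_congr_right fun _ => by omega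

theorem ncard_level_eq (h : Γ.IsLevelled φ) (i j : ℤ) :
    (φ ⁻¹' {i}).ncard = (φ ⁻¹' {j}).ncard := by
  obtain ⟨u, rfl⟩ := h.surjective i
  obtain ⟨v, rfl⟩ := h.surjective j
  obtain ⟨g, -, hg⟩ := h.translate u v
  rw [← Set.ncard_smul_set g]
  congr 1
  ext w
  obtain ⟨w, rfl⟩ := MulAction.surjective g w
  rw [Set.smul_mem_smul_set_iff]
  simp only [Set.mem_preimage, Set.mem_singleton_iff, hg w]
  omega

/-- Counting the arcs between two consecutive levels in two ways. -/
theorem ncard_outAt_one (h : Γ.IsLevelled φ) (v : V) :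
    (Γ.outAt φ v 1).ncard = (Γ.inAt φ v (-1)).ncard := by
  classical
  -- All levels have the same positive size, which cancels from the double count.
  have key := Finset.card_mul_eq_card_mul (s := (h.finite 0).toFinset) (t := (h.finite 1).toFinset)
    Γ.Adj (m := (Γ.outAt φ v 1).ncard) (n := (Γ.inAt φ v (-1)).ncard) ?_ ?_
  · rw [← Set.ncard_eq_toFinset_card _ (h.finite 0), ← Set.ncard_eq_toFinset_card _ (h.finite 1),
      h.ncard_level_eq 1 0] at key
    obtain ⟨w, hw⟩ := h.surjective 0
    exact Nat.eq_of_mul_eq_mul_left ((Set.ncard_pos (h.finite 0)).2 ⟨w, hw⟩) key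
  · intro a haa
    have ha0 : φ a = 0 := by simpa using haa
    rw [h.ncard_outAt_eq v a, ← Set.ncard_coe_finset]
    congr 1
    ext w
    simp [outAt, ha0, and_comm]
  · intro b hb
    have hb1 : φ b = 1 := by simpa using hb
    rw [h.ncard_inAt_eq v b, ← Set.ncard_coe_finset]
    congr 1
    ext w
    simp [inAt, hb1, and_comm]

theorem outSet_eq (h : Γ.IsLevelled φ) (v : V) :
    Γ.outSet v = Γ.outAt φ v 1 ∪ Γ.outAt φ v (-1) := by
  ext w
  simp only [outSet, outAt, Set.mem_union, Set.mem_ofPred_eq, ← and_or_left]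
  refine ⟨fun hw => ⟨hw, ?_⟩, fun hw => hw.1⟩
  have := h.adj hw
  omega

theorem inSet_eq (h : Γ.IsLevelled φ) (v : V) :
    Γ.inSet v = Γ.inAt φ v 1 ∪ Γ.inAt φ v (-1) := by
  ext w
  simp only [inSet, inAt, Set.mem_union, Set.mem_ofPred_eq, ← and_or_left]
  refine ⟨fun hw => ⟨hw, ?_⟩, fun hw => hw.1⟩
  have := h.adj hw
  omega

theorem outValency_eq (h : Γ.IsLevelled φ) (v : V) :
    Γ.outValency v = ((Γ.outAt φ v 1).ncard + (Γ.outAt φ v (-1)).ncard : ℕ) := by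
  rw [outValency, h.outSet_eq, ← Set.cast_ncard ((h.finite_outAt v 1).union (h.finite_outAt v (-1))),
    Set.ncard_union_eq ?_ (h.finite_outAt v 1) (h.finite_outAt v (-1))]
  rw [Set.disjoint_left]
  rintro w ⟨-, h1⟩ ⟨-, h2⟩
  omega

theorem inValency_eq (h : Γ.IsLevelled φ) (v : V) :
    Γ.inValency v = ((Γ.inAt φ v 1).ncard + (Γ.inAt φ v (-1)).ncard : ℕ) := by
  rw [inValency, h.inSet_eq, ← Set.cast_ncard ((h.finite_inAt v 1).union (h.finite_inAt v (-1))),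
    Set.ncard_union_eq ?_ (h.finite_inAt v 1) (h.finite_inAt v (-1))]
  rw [Set.disjoint_left]
  rintro w ⟨-, h1⟩ ⟨-, h2⟩
  omega

end IsLevelled

theorem IsCaseOne.ncard_outAt_neg (h : Γ.IsCaseOne N φ) (ha : Γ.IsArcTransitive) (v : V) (d : ℤ) :
    (Γ.outAt φ v (-d)).ncard = (Γ.outAt φ v d).ncard := by
  obtain ⟨g, hgv, hg⟩ := h.exists_reflection ha v
  rw [← Set.ncard_smul_set g]
  congr 1
  ext w
  obtain ⟨w, rfl⟩ := MulAction.surjective g w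
  rw [Set.smul_mem_smul_set_iff]
  simp only [outAt, Set.mem_ofPred_eq, hg w]
  rw [← smul_adj_iff g, hgv]
  exact and_congr_right fun _ => by omega

theorem IsCaseOne.ncard_inAt_neg (h : Γ.IsCaseOne N φ) (ha : Γ.IsArcTransitive) (v : V) (d : ℤ) :
    (Γ.inAt φ v (-d)).ncard = (Γ.inAt φ v d).ncard := by
  obtain ⟨g, hgv, hg⟩ := h.exists_reflection ha v
  rw [← Set.ncard_smul_set g]
  congr 1
  ext w
  obtain ⟨w, rfl⟩ := MulAction.surjective g w
  rw [Set.smul_mem_smul_set_iff]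
  simp only [inAt, Set.mem_ofPred_eq, hg w]
  rw [← smul_adj_iff g, hgv]
  exact and_congr_right fun _ => by omega

theorem IsLevelMap.inValency_eq_outValency (h : Γ.IsLevelMap N φ) (hv : Γ.IsVertexTransitive)
    (ha : Γ.IsArcTransitive) (v : V) : Γ.inValency v = Γ.outValency v := by
  have hl := h.isLevelled hv ha
  rw [hl.inValency_eq, hl.outValency_eq, hl.ncard_outAt_one]
  rcases h with h | h
  · rw [h.ncard_outAt_neg ha, hl.ncard_outAt_one, h.ncard_inAt_neg ha]
  · have h1 : Γ.outAt φ v (-1) = ∅ := by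
      ext w
      simp only [outAt, Set.mem_ofPred_eq, Set.mem_empty_iff_false, iff_false]
      rintro ⟨h1, h2⟩
      have := h.adj h1
      omega
    have h2 : Γ.inAt φ v 1 = ∅ := by
      ext w
      simp only [inAt, Set.mem_ofPred_eq, Set.mem_empty_iff_false, iff_false]
      rintro ⟨h1, h2⟩
      have := h.adj h1
      omega
    rw [h1, h2, add_comm]

theorem IsCaseOne.outValency_eq (h : Γ.IsCaseOne N φ) (hv : Γ.IsVertexTransitive)
    (ha : Γ.IsArcTransitive) (v : V) :
    Γ.outValency v = (2 * (Γ.outAt φ v 1).ncard : ℕ) := by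
  rw [(h.isLevelled hv ha).outValency_eq, h.ncard_outAt_neg ha, two_mul]

/-! ### Vertex stabilizers -/

/-- In the first case, if the elements of a vertex stabilizer which preserve the levels fix all
neighbours, then the stabilizer has at most two elements. -/
theorem IsCaseOne.card_stabilizer_le (h : Γ.IsCaseOne N φ) (hv : Γ.IsVertexTransitive)
    (ha : Γ.IsArcTransitive) (hc : Γ.IsConnected)
    (hfix : ∀ (x : V) (g : Γ.Aut), g • x = x → (∀ y, φ (g • y) = φ y) →
      (∀ y ∈ Γ.inSet x, g • y = y) ∧ ∀ y ∈ Γ.outSet x, g • y = y) (v : V) :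
    Cardinal.mk (MulAction.stabilizer Γ.Aut v) ≤ 2 := by
  have hl := h.isLevelled hv ha
  have htriv : ∀ g : Γ.Aut, g • v = v → (∀ y, φ (g • y) = φ y) → g = 1 := by
    intro g hg hgφ
    refine RelIso.ext fun x => hc.mem_of_closed (S := {x | g • x = x}) (fun a b hab => ?_) hg x
    exact ⟨fun hga => (hfix a g hga hgφ).2 b hab, fun hgb => (hfix b g hgb hgφ).1 a hab⟩
  -- An element fixing `v` either preserves all levels or reflects them about that of `v`. Two
  -- elements of the same type differ by a level-preserving one, which is trivial by `htriv`.
  let f : MulAction.stabilizer Γ.Aut v → ULift.{u} Prop := fun g => ⟨∀ y, φ (g.1 • y) = φ y⟩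
  have hf : Function.Injective f := by
    intro g k hgk
    have hiff : (∀ y, φ (g.1 • y) = φ y) ↔ ∀ y, φ (k.1 • y) = φ y :=
      iff_of_eq (congrArg ULift.down hgk)
    have haff : ∀ g : MulAction.stabilizer Γ.Aut v, (∀ y, φ (g.1 • y) = φ y) ∨
        ∀ y, φ (g.1 • y) = 2 * φ v - φ y := fun g => by
      rcases hl.affine g.1 with ⟨c, hc⟩ | ⟨c, hc⟩
      · have h1 := hc v
        rw [g.2] at h1
        exact .inl fun y => by rw [hc]; omega
      · have h1 := hc v
        rw [g.2] at h1
        exact .inr fun y => by rw [hc]; omega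
    have hsame : ∀ y, φ (g.1 • y) = φ (k.1 • y) := by
      intro y
      by_cases hg : ∀ y, φ (g.1 • y) = φ y
      · rw [hg, hiff.1 hg]
      · rw [(haff g).resolve_left hg, (haff k).resolve_left fun hk => hg (hiff.2 hk)]
    have h1 : (k.1⁻¹ * g.1 : Γ.Aut) = 1 := by
      refine htriv _ ?_ fun y => ?_
      · rw [mul_smul, g.2, inv_smul_eq_iff, k.2]
      · have := hl.smul_eq k.1⁻¹ (hsame y)
        rwa [inv_smul_smul, ← mul_smul] at this
    exact Subtype.ext (inv_mul_eq_one.1 h1).symm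
  calc Cardinal.mk (MulAction.stabilizer Γ.Aut v) ≤ Cardinal.mk (ULift.{u} Prop) :=
        Cardinal.mk_le_of_injective hf
    _ = 2 := by simp

/-- The level-preserving elements form a normal subgroup `K` of the stabilizer. It is intransitive
on in- and on out-neighbours, as both kinds occur above and below, so quasi-primitivity makes it act
trivially on them. -/
theorem IsCaseOne.card_stabilizer_le_of_isLocallyQuasiPrimitive (h : Γ.IsCaseOne N φ)
    (hv : Γ.IsVertexTransitive) (ha : Γ.IsArcTransitive) (hc : Γ.IsConnected)
    (hq : Γ.IsLocallyQuasiPrimitive) (v : V) :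
    Cardinal.mk (MulAction.stabilizer Γ.Aut v) ≤ 2 := by
  have hl := h.isLevelled hv ha
  refine h.card_stabilizer_le hv ha hc (fun x g hgx hg => ?_) v
  let K : Subgroup (MulAction.stabilizer Γ.Aut x) :=
    { carrier := {k | ∀ y, φ (k.1 • y) = φ y}
      mul_mem' := fun {a b} hha hb y => by
        change φ ((a.1 * b.1) • y) = φ y
        rw [mul_smul, hha, hb]
      one_mem' := fun y => rfl
      inv_mem' := fun {a} hha y => by
        have := hha (a.1⁻¹ • y)
        rw [smul_inv_smul] at this
        exact this.symm }
  have hK : K.Normal := ⟨fun k hk a y => by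
    change φ ((a.1 * k.1 * a.1⁻¹) • y) = φ y
    rw [mul_smul, mul_smul, hl.smul_eq a.1 (hk (a.1⁻¹ • y)), smul_inv_smul]⟩
  obtain ⟨⟨u₁, hu₁, hu₁'⟩, ⟨u₂, hu₂, hu₂'⟩, ⟨w₁, hw₁, hw₁'⟩, ⟨w₂, hw₂, hw₂'⟩⟩ := h.exists_neighbours x
  let gx : K := ⟨⟨g, hgx⟩, hg⟩
  constructor
  · intro y hy
    have hfp : MulAction.fixedPoints K (Γ.inAction x) = .univ := by
      by_contra hne
      have := (hq x).1.isPretransitive_of_normal hne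
      obtain ⟨k, hk⟩ := MulAction.exists_smul_eq K (⟨u₁, hu₁⟩ : Γ.inAction x) ⟨u₂, hu₂⟩
      have h1 : k.1.1 • u₁ = u₂ := congrArg Subtype.val hk
      have h2 := k.2 u₁
      rw [h1] at h2
      omega
    have := (Set.eq_univ_iff_forall.1 hfp ⟨y, hy⟩) gx
    exact congrArg Subtype.val this
  · intro y hy
    have hfp : MulAction.fixedPoints K (Γ.outAction x) = .univ := by
      by_contra hne
      have := (hq x).2.isPretransitive_of_normal hne
      obtain ⟨k, hk⟩ := MulAction.exists_smul_eq K (⟨w₁, hw₁⟩ : Γ.outAction x) ⟨w₂, hw₂⟩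
      have h1 : k.1.1 • w₁ = w₂ := congrArg Subtype.val hk
      have h2 := k.2 w₁
      rw [h1] at h2
      omega
    have := (Set.eq_univ_iff_forall.1 hfp ⟨y, hy⟩) gx
    exact congrArg Subtype.val this

/-- Each vertex has exactly one out-neighbour and one in-neighbour in each adjacent level, so an
element that fixes the vertex and preserves the levels fixes them all. -/
theorem IsCaseOne.card_stabilizer_le_of_outValency (h : Γ.IsCaseOne N φ)
    (hv : Γ.IsVertexTransitive) (ha : Γ.IsArcTransitive) (hc : Γ.IsConnected) {v : V}
    (hval : Γ.outValency v = 2) : Cardinal.mk (MulAction.stabilizer Γ.Aut v) ≤ 2 := by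
  have hl := h.isLevelled hv ha
  have h1 : (Γ.outAt φ v 1).ncard = 1 := by
    rw [h.outValency_eq hv ha] at hval
    have : 2 * (Γ.outAt φ v 1).ncard = 2 := by exact_mod_cast hval
    omega
  have hout : ∀ x d, d = 1 ∨ d = -1 → (Γ.outAt φ x d).ncard = 1 := by
    rintro x d (rfl | rfl)
    · rw [hl.ncard_outAt_eq x v, h1]
    · rw [h.ncard_outAt_neg ha, hl.ncard_outAt_eq x v, h1]
  have hin : ∀ x d, d = 1 ∨ d = -1 → (Γ.inAt φ x d).ncard = 1 := by
    have h2 : ∀ x, (Γ.inAt φ x (-1)).ncard = 1 := fun x => by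
      rw [← hl.ncard_outAt_one, hout x 1 (.inl rfl)]
    rintro x d (rfl | rfl)
    · rw [← h.ncard_inAt_neg ha, h2]
    · exact h2 x
  refine h.card_stabilizer_le hv ha hc (fun x g hgx hg => ⟨fun y hy => ?_, fun y hy => ?_⟩) v
  · have hd : φ y - φ x = 1 ∨ φ y - φ x = -1 := by
      have := hl.adj hy
      omega
    obtain ⟨z, hz⟩ := Set.ncard_eq_one.1 (hin x _ hd)
    have h3 : y ∈ Γ.inAt φ x (φ y - φ x) := ⟨hy, by omega⟩
    have h4 : g • y ∈ Γ.inAt φ x (φ y - φ x) :=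
      ⟨by have := smul_adj g hy; rwa [hgx] at this, by rw [hg]; omega⟩
    rw [hz] at h3 h4
    exact h4.trans h3.symm
  · have hd : φ y - φ x = 1 ∨ φ y - φ x = -1 := by
      have := hl.adj hy
      omega
    obtain ⟨z, hz⟩ := Set.ncard_eq_one.1 (hout x _ hd)
    have h3 : y ∈ Γ.outAt φ x (φ y - φ x) := ⟨hy, by omega⟩
    have h4 : g • y ∈ Γ.outAt φ x (φ y - φ x) :=
      ⟨by have := smul_adj g hy; rwa [hgx] at this, by rw [hg]; omega⟩
    rw [hz] at h3 h4
    exact h4.trans h3.symm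

/-- A 2-arc going up and then down ends on its initial level, while one going up twice does not;
automorphisms respect equality of levels. -/
theorem IsCaseOne.not_isKArcTransitive_two (h : Γ.IsCaseOne N φ) (hv : Γ.IsVertexTransitive)
    (ha : Γ.IsArcTransitive) (v : V) : ¬ Γ.IsKArcTransitive 2 := by
  intro h2
  have hl := h.isLevelled hv ha
  obtain ⟨-, -, -, ⟨w, hw, hw'⟩⟩ := h.exists_neighbours v
  obtain ⟨-, -, ⟨x, hx, hx'⟩, ⟨y, hy, hy'⟩⟩ := h.exists_neighbours w
  have harc : ∀ z, Γ.Adj w z → Γ.IsKArc 2 ![v, w, z] := by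
    intro z hz i
    fin_cases i
    · exact hw
    · exact hz
  obtain ⟨g, hg⟩ := h2 _ _ (harc x hx) (harc y hy)
  have g0 : g • v = v := hg 0
  have g2 : g • x = y := hg 2
  have h3 := hl.smul_eq g (show φ x = φ v by omega)
  rw [g0, g2] at h3
  omega

end Digraph

end

/-! ### The theorem -/

theorem corollary9 {V : Type u} (Γ : Digraph V) (hv : Γ.IsVertexTransitive)
    (ha : Γ.IsArcTransitive) (h2 : Γ.IsTwoEnded) :
    -- the levels exist
    (∃ N φ, Γ.IsLevelMap N φ) ∧
    -- (a)
    (∀ N φ, Γ.IsLevelMap N φ →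
      (Γ.CaseOneOccurs ↔ ∀ v : V,
        (∃ u ∈ Γ.inSet v, φ u = φ v - 1) ∧ (∃ u ∈ Γ.inSet v, φ u = φ v + 1) ∧
        (∃ w ∈ Γ.outSet v, φ w = φ v - 1) ∧ (∃ w ∈ Γ.outSet v, φ w = φ v + 1)) ∧
      (Γ.CaseOneOccurs →
        (∀ v : V,
          Cardinal.mk {w : V // w ∈ Γ.outSet v ∧ φ w = φ v - 1} =
            Cardinal.mk {w : V // w ∈ Γ.outSet v ∧ φ w = φ v + 1} ∧
          Cardinal.mk {u : V // u ∈ Γ.inSet v ∧ φ u = φ v - 1} =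
            Cardinal.mk {u : V // u ∈ Γ.inSet v ∧ φ u = φ v + 1}) ∧
        ∀ i : ℤ,
          (Γ.span (φ ⁻¹' {i} ∪ φ ⁻¹' {i + 1})).IsBipartite ∧
          (Γ.span (φ ⁻¹' {i} ∪ φ ⁻¹' {i + 1})).IsVertexTransitive ∧
          (Γ.span (φ ⁻¹' {i} ∪ φ ⁻¹' {i + 1})).IsArcTransitive)) ∧
    -- (b)
    (∀ N φ, Γ.IsLevelMap N φ →
      (Γ.CaseTwoOccurs ↔ ∀ v : V,
        (∀ u ∈ Γ.inSet v, φ u = φ v - 1) ∧ (∀ w ∈ Γ.outSet v, φ w = φ v + 1)) ∧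
      (Γ.CaseTwoOccurs → ∀ i : ℤ,
        (Γ.span (φ ⁻¹' {i} ∪ φ ⁻¹' {i + 1})).IsBipartite ∧
        (Γ.span (φ ⁻¹' {i} ∪ φ ⁻¹' {i + 1})).IsArcTransitive ∧
        ∀ x y : ↥(φ ⁻¹' {i} ∪ φ ⁻¹' {i + 1}),
          (Γ.span (φ ⁻¹' {i} ∪ φ ⁻¹' {i + 1})).Adj x y → φ x = i ∧ φ y = i + 1)) ∧
    -- (c)
    (∀ v : V, Γ.inValency v = Γ.outValency v) ∧
    -- (d)
    (∀ (v : V) (k : ℕ), Γ.outValency v = ((2 * k + 1 : ℕ) : Cardinal) → Γ.PropertyZ) ∧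
    -- (e)
    (Γ.IsKArcTransitive 2 →
      (∀ N φ, Γ.IsLevelMap N φ → Nonempty ((Γ.orbitQuotient N).Iso Digraph.directedLine)) ∧
      Γ.PropertyZ) ∧
    -- (f)
    (∀ v : V, Γ.IsLocallyQuasiPrimitive →
      2 < Cardinal.mk (MulAction.stabilizer Γ.Aut v) → Γ.PropertyZ) ∧
    -- (g)
    (∀ v : V, Γ.outValency v = 2 →
      2 < Cardinal.mk (MulAction.stabilizer Γ.Aut v) → Γ.PropertyZ) := by
  obtain ⟨N₀, φ₀, h₀⟩ := Digraph.exists_isLevelMap hv ha h2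
  have excl : ∀ {N N' : Subgroup Γ.Aut} {φ φ' : V → ℤ}, Γ.IsCaseOne N φ → ¬ Γ.IsCaseTwo N' φ' :=
    fun h h' => h'.not_isCaseOne hv ha h
  -- Property Z follows whenever case (i) is impossible, so the last four claims only have to refute
  -- that case.
  have hZ : (∀ {N : Subgroup Γ.Aut} {φ : V → ℤ}, ¬ Γ.IsCaseOne N φ) → Γ.PropertyZ := fun h =>
    (h₀.resolve_left h).propertyZ h2.1
  refine ⟨⟨N₀, φ₀, h₀⟩, fun N φ h => ⟨⟨?_, fun hn => ?_⟩, ?_⟩, fun N φ h => ⟨⟨?_, fun hn => ?_⟩, ?_⟩,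
    h₀.inValency_eq_outValency hv ha, fun v k hk => hZ fun {N φ} h => ?_,
    fun h3 => ⟨fun N φ h => ?_, hZ fun {N φ} h => ?_⟩,
    fun v hq hs => hZ fun {N φ} h => ?_, fun v hval hs => hZ fun {N φ} h => ?_⟩
  · rintro ⟨N', φ', h'⟩ v
    exact (h.resolve_right (excl h')).exists_neighbours v
  · refine ⟨N, φ, h.resolve_right fun h' => ?_⟩
    obtain ⟨v, -⟩ := (h'.isLevelled hv).surjective 0
    obtain ⟨-, ⟨u, hu, hu'⟩, -⟩ := hn v
    have := h'.adj hu
    omega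
  · rintro ⟨N', φ', h'⟩
    have h1 := h.resolve_right (excl h')
    refine ⟨fun v => ?_, fun i => ⟨(h1.isLevelled hv ha).span_isBipartite i,
      h1.span_isVertexTransitive hv ha i, (h1.isLevelled hv ha).span_isArcTransitive ha i⟩⟩
    have hl := h1.isLevelled hv ha
    have e1 := h1.ncard_outAt_neg ha v 1
    have e2 := h1.ncard_inAt_neg ha v 1
    have e3 := congrArg (Nat.cast : ℕ → Cardinal.{u}) e1
    have e4 := congrArg (Nat.cast : ℕ → Cardinal.{u}) e2
    rw [Set.cast_ncard (hl.finite_outAt v _), Set.cast_ncard (hl.finite_outAt v _)] at e3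
    rw [Set.cast_ncard (hl.finite_inAt v _), Set.cast_ncard (hl.finite_inAt v _)] at e4
    exact ⟨e3, e4⟩
  · rintro ⟨N', φ', h'⟩ v
    have h1 := h.resolve_left fun h1 => excl h1 h'
    refine ⟨fun u hu => ?_, fun w hw => h1.adj hw⟩
    have := h1.adj hu
    omega
  · refine ⟨N, φ, h.resolve_left fun h' => ?_⟩
    obtain ⟨v, -⟩ := (h'.isLevelled hv ha).surjective 0
    obtain ⟨-, -, ⟨w, hw, hw'⟩, -⟩ := h'.exists_neighbours v
    have := (hn v).2 w hw
    omega
  · rintro ⟨N', φ', h'⟩ i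
    have h1 := h.resolve_left fun h1 => excl h1 h'
    have hl := h1.isLevelled hv
    refine ⟨hl.span_isBipartite i, hl.span_isArcTransitive ha i, fun x y hxy => ?_⟩
    have hx := Digraph.mem_levels.1 x.2
    have hy := Digraph.mem_levels.1 y.2
    have := h1.adj hxy
    omega
  · rw [h.outValency_eq hv ha] at hk
    have := Nat.cast_injective hk
    omega
  · have h1 := h.resolve_left fun h1 => by
      obtain ⟨v, -⟩ := (h1.isLevelled hv ha).surjective 0
      exact h1.not_isKArcTransitive_two hv ha v h3
    obtain ⟨e, -⟩ := h1.quotient_iso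
    exact ⟨e⟩
  · obtain ⟨v, -⟩ := (h.isLevelled hv ha).surjective 0
    exact h.not_isKArcTransitive_two hv ha v h3
  · exact (h.card_stabilizer_le_of_isLocallyQuasiPrimitive hv ha h2.1 hq v).not_gt hs
  · exact (h.card_stabilizer_le_of_outValency hv ha h2.1 hval).not_gt hs
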